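/- Let $\Bbbk$ be an algebraically closed field of characteristic zero and $n\ge 0$. Let $I_n^*$ be the dual symmetric inverse semigroup: its elements are the bijections between the sets of parts of two set partitions of $\{1,\dots,n\}$ (the domain and the codomain), composed from right to left through the join of the two middle partitions. For a set partition $\rho$ of $\{1,\dots,n\}$ with $k$ parts let $\varepsilon_\rho\in I_n^*$ be the identity map of the set of parts of $\rho$, let $\mathbf L_\rho$ be the $\mathcal L$-class of $\varepsilon_\rho$, and let $\Bbbk[\mathbf L_\rho]$ be the cell module, on which $\xi\in I_n^*$ acts by $\xi\cdot\zeta=\xi\zeta$ if $\xi\zeta\in\mathbf L_\rho$ and $\xi\cdot\zeta=0$ otherwise. The maximal subgroup at $\varepsilon_\rho$, which is identified with $S_k$ by an enumeration of the parts of $\rho$, acts on $\Bbbk[\mathbf L_\rho]$ from the right. For $\lambda\vdash k$, with Specht module $\mathbf S^\lambda$, put $\mathbf N^\lambda=\Bbbk[\mathbf L_\rho]\otimes_{\Bbbk[S_k]}\mathbf S^\lambda$; this is a simple $\Bbbk[I_n^*]$-module. Tensor products over $\Bbbk$ of $I_n^*$-modules carry the diagonal action, and $[V:S]$ denotes the multiplicity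 of a simple module $S$ as a composition factor of $V$. Let $Q_{k,l}^m$ be the set of $k\times l$ matrices with entries in $\{0,1\}$ that have exactly $m$ entries equal to $1$, no zero row and no zero column; $S_k\times S_l$ acts on it by permuting rows and columns. For $M\in Q_{k,l}^m$ let $H_M\subseteq S_k\times S_l$ be its stabilizer. It permutes the $1$-entries of $M$ faithfully, so a bijection between $\{1,\dots,m\}$ and the set of $1$-entries of $M$ identifies $H_M$ with a subgroup of $S_m$. Then, for all $k,l,m$ for which $\{1,\dots,n\}$ has set partitions with $k$, with $l$ and with $m$ parts, all $\lambda\vdash k$, $\mu\vdash l$, $\nu\vdash m$, every choice of such set partitions (with enumerations of their parts) in the definition of $\mathbf N^\lambda,\mathbf N^\mu,\mathbf N^\nu$, every cross-section $C\subseteq Q_{k,l}^m$ of the set of orbits $Q_{k,l}^m/(S_k\times S_l)$, and every choice, for each $M\in C$, of a bijection as above, $$[\mathbf N^\lambda\otimes_\Bbbk\mathbf N^\mu:\mathbf N^\nu]=\sum_{M\in C}\Big[\mathrm{Ind}_{H_M}^{S_m}\mathrm{Res}^{S_k\times S_l}_{H_M}\big(\mathbf S^\lambda\otimes_\Bbbk\mathbf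 S^\mu\big):\mathbf S^\nu\Big].$$ -/

import Mathlib

open scoped TensorProduct

noncomputable section

/-! ### The dual symmetric inverse semigroup -/

/-- An element of the dual symmetric inverse semigroup on `X`: a set partition `dom` of `X`,
a set partition `cod` of `X`, and a bijection from the parts of `dom` to the parts of `cod`.
Set partitions are encoded as equivalence relations. -/
structure DualSymInv (X : Type*) where
  dom : Setoid X
  cod : Setoid X
  bij : Quotient dom ≃ Quotient cod

namespace DualSymInv

variable {X : Type*}

/-- `ξ.rel x y`: the part of `x` in `dom ξ` is sent by `ξ` to the part of `y` in `cod ξ`. -/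
def rel (ξ : DualSymInv X) (x y : X) : Prop :=
  ξ.bij (Quotient.mk ξ.dom x) = Quotient.mk ξ.cod y

/-- For `r ≤ θ`, the map from the parts of `r` to the parts of `θ` sending a part to the
part containing it. -/
def coarsen {r θ : Setoid X} (h : r ≤ θ) : Quotient r → Quotient θ :=
  Quotient.lift (fun x => Quotient.mk θ x) (fun _ _ hxy => Quotient.sound (h hxy))

/-- In the composition `ξ ∘ ζ` (first `ζ`, then `ξ`), the middle partition is the join
of `cod ζ` and `dom ξ`, i.e. the finest set partition coarser than both. -/
def mid (ξ ζ : DualSymInv X) : Setoid X := ζ.cod ⊔ ξ.dom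

/-- A point goes along `ζ` to a part of the middle partition. -/
def toMid (ξ ζ : DualSymInv X) (x : X) : Quotient (mid ξ ζ) :=
  coarsen (le_sup_left : ζ.cod ≤ mid ξ ζ) (ζ.bij (Quotient.mk ζ.dom x))

/-- A point goes backwards along `ξ` to a part of the middle partition. -/
def fromMid (ξ ζ : DualSymInv X) (z : X) : Quotient (mid ξ ζ) :=
  coarsen (le_sup_right : ξ.dom ≤ mid ξ ζ) (ξ.bij.symm (Quotient.mk ξ.cod z))

theorem coarsen_surjective {r θ : Setoid X} (h : r ≤ θ) : Function.Surjective (coarsen h) := by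
  intro q
  induction q using Quotient.inductionOn with
  | h x => exact ⟨Quotient.mk r x, rfl⟩

theorem toMid_surjective (ξ ζ : DualSymInv X) : Function.Surjective (toMid ξ ζ) :=
  (coarsen_surjective _).comp (ζ.bij.surjective.comp Quotient.mk_surjective)

theorem fromMid_surjective (ξ ζ : DualSymInv X) : Function.Surjective (fromMid ξ ζ) :=
  (coarsen_surjective _).comp (ξ.bij.symm.surjective.comp Quotient.mk_surjective)

/-- Composition, from right to left: the parts of `dom (ξ * ζ)` and of `cod (ξ * ζ)` are the
preimages of the parts of the middle partition, and two of them correspond to each other if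
they come from the same part of the middle partition. -/
instance : Mul (DualSymInv X) where
  mul ξ ζ :=
    { dom := Setoid.ker (toMid ξ ζ)
      cod := Setoid.ker (fromMid ξ ζ)
      bij := (Setoid.quotientKerEquivOfSurjective _ (toMid_surjective ξ ζ)).trans
        (Setoid.quotientKerEquivOfSurjective _ (fromMid_surjective ξ ζ)).symm }

/-- The idempotent of the set partition `ρ` with the permutation `g` of its parts: the element
`(ρ, ρ, g)`. These elements form the maximal subgroup of `ρ`. -/
def ofPerm (ρ : Setoid X) (g : Equiv.Perm (Quotient ρ)) : DualSymInv X := ⟨ρ, ρ, g⟩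

/-- The idempotent given by the identity map on the parts of `ρ`. -/
def idem (ρ : Setoid X) : DualSymInv X := ofPerm ρ 1

instance : One (DualSymInv X) where
  one := idem ⊥

theorem dom_iff (ξ : DualSymInv X) (x x' : X) :
    ξ.dom x x' ↔ ∃ y, ξ.rel x y ∧ ξ.rel x' y := by
  constructor
  · intro h
    obtain ⟨y, hy⟩ := Quotient.mk_surjective (ξ.bij (Quotient.mk ξ.dom x))
    exact ⟨y, hy.symm, by unfold rel; rw [hy, Quotient.sound h]⟩
  · rintro ⟨y, h, h'⟩
    exact Quotient.exact (ξ.bij.injective (h.trans h'.symm))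

theorem cod_iff (ξ : DualSymInv X) (y y' : X) :
    ξ.cod y y' ↔ ∃ x, ξ.rel x y ∧ ξ.rel x y' := by
  constructor
  · intro h
    obtain ⟨x, hx⟩ := Quotient.mk_surjective (ξ.bij.symm (Quotient.mk ξ.cod y))
    have hx' : ξ.bij (Quotient.mk ξ.dom x) = Quotient.mk ξ.cod y := by rw [hx]; simp
    exact ⟨x, hx', hx'.trans (Quotient.sound h)⟩
  · rintro ⟨x, h, h'⟩
    exact Quotient.exact (h.symm.trans h')

theorem exists_rel_right (ξ : DualSymInv X) (x : X) : ∃ y, ξ.rel x y := by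
  obtain ⟨y, hy, _⟩ := (ξ.dom_iff x x).1 (ξ.dom.refl x)
  exact ⟨y, hy⟩

theorem exists_rel_left (ξ : DualSymInv X) (y : X) : ∃ x, ξ.rel x y := by
  obtain ⟨x, hx, _⟩ := (ξ.cod_iff y y).1 (ξ.cod.refl y)
  exact ⟨x, hx⟩

theorem ext_rel {ξ ζ : DualSymInv X} (h : ∀ x y, ξ.rel x y ↔ ζ.rel x y) : ξ = ζ := by
  have hd : ξ.dom = ζ.dom := Setoid.ext fun x y => by simp [dom_iff, h]
  have hc : ξ.cod = ζ.cod := Setoid.ext fun x y => by simp [cod_iff, h]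
  obtain ⟨d, c, b⟩ := ξ
  obtain ⟨d', c', b'⟩ := ζ
  obtain rfl : d = d' := hd
  obtain rfl : c = c' := hc
  congr 1
  ext q
  induction q using Quotient.inductionOn with
  | h x =>
    obtain ⟨y, hy⟩ := Quotient.mk_surjective (b (Quotient.mk d x))
    exact hy.symm.trans ((h x y).1 hy.symm).symm

/-- A relation `T` is difunctional if `T x z`, `T x' z`, `T x' z'` imply `T x z'`. -/
def Difunctional (T : X → X → Prop) : Prop :=
  ∀ x x' z z', T x z → T x' z → T x' z' → T x z'

theorem rel_difunctional (ξ : DualSymInv X) : Difunctional ξ.rel :=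
  fun _ _ _ _ h1 h2 h3 => h1.trans (h2.symm.trans h3)

theorem rel_mul_iff (ξ ζ : DualSymInv X) (x z : X) :
    (ξ * ζ).rel x z ↔ toMid ξ ζ x = fromMid ξ ζ z := by
  change (Setoid.quotientKerEquivOfSurjective _ (fromMid_surjective ξ ζ)).symm
    (Setoid.quotientKerEquivOfSurjective _ (toMid_surjective ξ ζ) (Quotient.mk _ x)) =
      Quotient.mk _ z ↔ _
  rw [Equiv.symm_apply_eq]
  rfl

theorem rel_mul_of_rel {ξ ζ : DualSymInv X} {x y z : X} (h1 : ζ.rel x y) (h2 : ξ.rel y z) :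
    (ξ * ζ).rel x z := by
  rw [rel_mul_iff, toMid, fromMid, show ζ.bij (Quotient.mk ζ.dom x) = Quotient.mk _ y from h1,
    (Equiv.symm_apply_eq _).2 (show Quotient.mk ξ.cod z = ξ.bij (Quotient.mk _ y) from h2.symm)]
  rfl

/-- The relation of `ξ * ζ` is the smallest difunctional relation that contains the composite
of the relations of `ζ` and `ξ`. -/
theorem rel_mul_min {ξ ζ : DualSymInv X} {T : X → X → Prop} (hT : Difunctional T)
    (h : ∀ x y z, ζ.rel x y → ξ.rel y z → T x z) {x z : X} (hxz : (ξ * ζ).rel x z) : T x z := by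
  obtain ⟨y, hy⟩ := ζ.exists_rel_right x
  obtain ⟨y', hy'⟩ := ξ.exists_rel_left z
  rw [rel_mul_iff, toMid, fromMid, show ζ.bij (Quotient.mk ζ.dom x) = Quotient.mk _ y from hy,
    (Equiv.symm_apply_eq _).2 (show Quotient.mk ξ.cod z = ξ.bij (Quotient.mk _ y') from hy'.symm)]
    at hxz
  have hθ : mid ξ ζ y y' := Quotient.exact hxz
  let W : X → Set X := fun y => {x | ∃ z, ξ.rel y z ∧ T x z}
  have key : mid ξ ζ ≤ Setoid.ker W := by
    refine sup_le ?_ ?_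
    · have half : ∀ a b, ζ.cod a b → W a ⊆ W b := by
        rintro a b hab u ⟨v, hv, huv⟩
        obtain ⟨w, hwa, hwb⟩ := (ζ.cod_iff a b).1 hab
        obtain ⟨v', hv'⟩ := ξ.exists_rel_right b
        exact ⟨v', hv', hT _ _ _ _ huv (h _ _ _ hwa hv) (h _ _ _ hwb hv')⟩
      intro a b hab
      exact Set.Subset.antisymm (half a b hab) (half b a (ζ.cod.symm hab))
    · have half : ∀ a b, ξ.dom a b → W a ⊆ W b := by
        rintro a b hab u ⟨v, hv, huv⟩
        obtain ⟨w, hwa, hwb⟩ := (ξ.dom_iff a b).1 hab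
        refine ⟨v, ?_, huv⟩
        exact ξ.rel_difunctional _ _ _ _ hwb hwa hv
      intro a b hab
      exact Set.Subset.antisymm (half a b hab) (half b a (ξ.dom.symm hab))
  have hW : W y = W y' := key hθ
  obtain ⟨v, hv⟩ := ξ.exists_rel_right y
  have hx : x ∈ W y' := hW ▸ (⟨v, hv, h _ _ _ hy hv⟩ : x ∈ W y)
  obtain ⟨v', hv', hxv'⟩ := hx
  obtain ⟨x', hx'⟩ := ζ.exists_rel_left y'
  exact hT _ _ _ _ hxv' (h _ _ _ hx' hv') (h _ _ _ hx' hy')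

theorem rel_one (x y : X) : (1 : DualSymInv X).rel x y ↔ x = y :=
  ⟨fun h => Quotient.exact h, fun h => h ▸ rfl⟩

/-- The dual symmetric inverse semigroup; its identity element is the identity map of the
partition into singletons. -/
instance : Monoid (DualSymInv X) where
  mul_assoc a b c := by
    refine ext_rel fun x y => ⟨fun hxy => ?_, fun hxy => ?_⟩
    · refine rel_mul_min (rel_difunctional _) (fun u v w huv hvw => ?_) hxy
      refine rel_mul_min (T := fun v w => ∀ u, c.rel u v → (a * (b * c)).rel u w) ?_ ?_ hvw u huv
      · intro v v' w w' h1 h2 h3 u hu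
        obtain ⟨u', hu'⟩ := c.exists_rel_left v'
        exact rel_difunctional _ _ _ _ _ (h1 u hu) (h2 u' hu') (h3 u' hu')
      · intro v p w hvp hpw u hu
        exact rel_mul_of_rel (rel_mul_of_rel hu hvp) hpw
    · refine rel_mul_min (rel_difunctional _) (fun u v w huv hvw => ?_) hxy
      refine rel_mul_min (T := fun u v => ∀ w, a.rel v w → (a * b * c).rel u w) ?_ ?_ huv w hvw
      · intro u u' v v' h1 h2 h3 w hw
        obtain ⟨w', hw'⟩ := a.exists_rel_right v
        exact rel_difunctional _ _ _ _ _ (h1 w' hw') (h2 w' hw') (h3 w hw)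
      · intro u p v hup hpv w hw
        exact rel_mul_of_rel hup (rel_mul_of_rel hpv hw)
  one_mul a := by
    refine ext_rel fun x y => ⟨fun h => ?_, fun h => ?_⟩
    · refine rel_mul_min (rel_difunctional _) (fun u v w huv hvw => ?_) h
      rw [rel_one] at hvw
      exact hvw ▸ huv
    · exact rel_mul_of_rel h ((rel_one _ _).2 rfl)
  mul_one a := by
    refine ext_rel fun x y => ⟨fun h => ?_, fun h => ?_⟩
    · refine rel_mul_min (rel_difunctional _) (fun u v w huv hvw => ?_) h
      rw [rel_one] at huv
      exact huv ▸ hvw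
    · exact rel_mul_of_rel ((rel_one _ _).2 rfl) h

theorem ofPerm_mul (ρ : Setoid X) (g h : Equiv.Perm (Quotient ρ)) :
    ofPerm ρ (g * h) = ofPerm ρ g * ofPerm ρ h := by
  refine ext_rel fun x z => ⟨fun hxz => ?_, fun hxz => ?_⟩
  · obtain ⟨y, hy⟩ := (ofPerm ρ h).exists_rel_right x
    refine rel_mul_of_rel hy ?_
    change g (Quotient.mk ρ y) = Quotient.mk ρ z
    rw [← show h (Quotient.mk ρ x) = Quotient.mk ρ y from hy]
    exact hxz
  · refine rel_mul_min (rel_difunctional _) (fun u v w huv hvw => ?_) hxz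
    change g (h (Quotient.mk ρ u)) = Quotient.mk ρ w
    rw [show h (Quotient.mk ρ u) = Quotient.mk ρ v from huv]
    exact hvw

end DualSymInv

/-! ### Left cells and cell modules -/

/-- Green's relation `L`: each of `a`, `b` is a left multiple of the other. -/
def GreenL {M : Type*} [Monoid M] (a b : M) : Prop :=
  (∃ x, x * a = b) ∧ ∃ y, y * b = a

/-- The left cell (the `L`-class) of `e`. -/
abbrev LeftCell {M : Type*} [Monoid M] (e : M) : Type _ := {p : M // GreenL p e}

theorem GreenL.of_mul {M : Type*} [Monoid M] {e p s t : M} (hp : GreenL p e)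
    (h : GreenL (s * t * p) e) : GreenL (t * p) e := by
  obtain ⟨⟨x, hx⟩, -⟩ := h
  obtain ⟨-, ⟨y, hy⟩⟩ := hp
  exact ⟨⟨x * s, by rw [← hx]; simp only [mul_assoc]⟩, ⟨t * y, by rw [mul_assoc, hy]⟩⟩

open Classical in
/-- The action of `s` on a basis element `p` of the cell module: `s * p` if this lies in
the left cell, and `0` otherwise. -/
def cellAct (𝕜 : Type*) [CommRing 𝕜] {M : Type*} [Monoid M] (e s : M) (p : LeftCell e) :
    LeftCell e →₀ 𝕜 :=
  if h : GreenL (s * p.1) e then Finsupp.single ⟨s * p.1, h⟩ 1 else 0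

/-- The cell module: the linearization of the left cell of `e`. -/
def cellRep (𝕜 : Type*) [CommRing 𝕜] {M : Type*} [Monoid M] (e : M) :
    Representation 𝕜 M (LeftCell e →₀ 𝕜) where
  toFun s := Finsupp.linearCombination 𝕜 (cellAct 𝕜 e s)
  map_one' := by
    ext p : 2
    have h : GreenL (1 * p.1) e := by rw [one_mul]; exact p.2
    simp only [cellAct, LinearMap.comp_apply, Finsupp.lsingle_apply,
      Finsupp.linearCombination_single, one_smul, Module.End.one_apply]
    rw [dif_pos h]
    congr 1
    exact Subtype.ext (one_mul _)
  map_mul' s t := by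
    ext p : 2
    simp only [LinearMap.comp_apply, Finsupp.lsingle_apply,
      Finsupp.linearCombination_single, one_smul, Module.End.mul_apply]
    by_cases h : GreenL (s * t * p.1) e
    · have h' := p.2.of_mul h
      have h2 : GreenL (s * (t * p.1)) e := by rw [← mul_assoc]; exact h
      simp only [cellAct, dif_pos h, dif_pos h', Finsupp.linearCombination_single, one_smul,
        dif_pos h2, mul_assoc]
    · by_cases h' : GreenL (t * p.1) e
      · have h2 : ¬ GreenL (s * (t * p.1)) e := by rw [← mul_assoc]; exact h
        simp only [cellAct, dif_neg h, dif_pos h', Finsupp.linearCombination_single, one_smul,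
          dif_neg h2]
      · simp only [cellAct, dif_neg h, dif_neg h', map_zero]

/-! ### Specht modules -/

/-- A Young tableau of shape `lam` with (distinct) entries in `Fin k`, all of which occur. -/
abbrev Tableau (lam : YoungDiagram) (k : ℕ) : Type := lam.cells ≃ Fin k

namespace Tableau

variable {lam : YoungDiagram} {k : ℕ}

/-- The row of the entry `i`. -/
def row (t : Tableau lam k) (i : Fin k) : ℕ := (t.symm i).1.1

/-- The column of the entry `i`. -/
def col (t : Tableau lam k) (i : Fin k) : ℕ := (t.symm i).1.2

/-- The polytabloid `∑ sign(σ) {σ t}`, over the column stabilizer of `t`. The tabloid `{t}`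
(the class of `t` under permutations within the rows) is encoded as the function that sends
an entry to its row, so that `{σ t}` is `row t ∘ σ⁻¹`. -/
def polytabloid (𝕜 : Type*) [CommRing 𝕜] (t : Tableau lam k) : (Fin k → ℕ) →₀ 𝕜 :=
  ∑ σ : Equiv.Perm (Fin k) with ∀ i, t.col (σ i) = t.col i,
    Finsupp.single (fun i => t.row (σ⁻¹ i)) ((Equiv.Perm.sign σ : ℤ) : 𝕜)

end Tableau

/-- The action of the symmetric group on linear combinations of tabloids. -/
def tabloidRep (𝕜 : Type*) [CommRing 𝕜] (k : ℕ) :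
    Representation 𝕜 (Equiv.Perm (Fin k)) ((Fin k → ℕ) →₀ 𝕜) where
  toFun σ := Finsupp.lmapDomain 𝕜 𝕜 (fun f i => f (σ⁻¹ i))
  map_one' := by ext p : 2; simp
  map_mul' s t := by ext p : 2; simp

theorem tabloidRep_polytabloid (𝕜 : Type*) [CommRing 𝕜] {lam : YoungDiagram} {k : ℕ}
    (t : Tableau lam k) (g : Equiv.Perm (Fin k)) :
    tabloidRep 𝕜 k g (t.polytabloid 𝕜) = Tableau.polytabloid 𝕜 (t.trans g) := by
  simp only [Tableau.polytabloid, map_sum]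
  refine Finset.sum_bij' (fun σ _ => g * σ * g⁻¹) (fun σ _ => g⁻¹ * σ * g) ?_ ?_ ?_ ?_ ?_
  · intro σ hσ
    simp only [Finset.mem_filter, Finset.mem_univ, true_and] at hσ ⊢
    intro i
    simpa [Tableau.col] using hσ (g⁻¹ i)
  · intro σ hσ
    simp only [Finset.mem_filter, Finset.mem_univ, true_and] at hσ ⊢
    intro i
    simpa [Tableau.col] using hσ (g i)
  · intro σ _; group
  · intro σ _; group
  · intro σ _
    simp only [tabloidRep, MonoidHom.coe_mk, OneHom.coe_mk, Finsupp.lmapDomain_apply,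
      Finsupp.mapDomain_single]
    congr 1
    · funext i
      simp [Tableau.row, mul_inv_rev]
    · rw [Equiv.Perm.sign_mul, Equiv.Perm.sign_mul, Equiv.Perm.sign_inv, mul_comm, ← mul_assoc,
        Int.units_mul_self, one_mul]

/-- The span of the polytabloids of shape `lam`. -/
def spechtSubmodule (𝕜 : Type*) [CommRing 𝕜] (k : ℕ) (lam : YoungDiagram) :
    Submodule 𝕜 ((Fin k → ℕ) →₀ 𝕜) :=
  Submodule.span 𝕜 (Set.range (Tableau.polytabloid (lam := lam) (k := k) 𝕜))

theorem tabloidRep_mem_spechtSubmodule (𝕜 : Type*) [CommRing 𝕜] (k : ℕ) (lam : YoungDiagram)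
    (g : Equiv.Perm (Fin k)) (v : (Fin k → ℕ) →₀ 𝕜) (hv : v ∈ spechtSubmodule 𝕜 k lam) :
    tabloidRep 𝕜 k g v ∈ spechtSubmodule 𝕜 k lam := by
  induction hv using Submodule.span_induction with
  | mem x hx =>
    obtain ⟨t, rfl⟩ := hx
    rw [tabloidRep_polytabloid]
    exact Submodule.subset_span ⟨_, rfl⟩
  | zero => rw [map_zero]; exact Submodule.zero_mem _
  | add x y _ _ hx hy => rw [map_add]; exact Submodule.add_mem _ hx hy
  | smul a x _ hx => rw [map_smul]; exact Submodule.smul_mem _ a hx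

/-- The underlying space of the Specht module. -/
def SpechtSpace (𝕜 : Type*) [CommRing 𝕜] (k : ℕ) (lam : YoungDiagram) : Type _ :=
  ↥(spechtSubmodule 𝕜 k lam)

instance (𝕜 : Type*) [CommRing 𝕜] (k : ℕ) (lam : YoungDiagram) :
    AddCommGroup (SpechtSpace 𝕜 k lam) :=
  inferInstanceAs (AddCommGroup ↥(spechtSubmodule 𝕜 k lam))

instance (𝕜 : Type*) [CommRing 𝕜] (k : ℕ) (lam : YoungDiagram) :
    Module 𝕜 (SpechtSpace 𝕜 k lam) :=
  inferInstanceAs (Module 𝕜 ↥(spechtSubmodule 𝕜 k lam))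

/-- The Specht module of the symmetric group of `Fin k` for a partition `lam` of `k`, given by
its Young diagram (with `k` cells). -/
def specht (𝕜 : Type*) [CommRing 𝕜] (k : ℕ) (lam : YoungDiagram) :
    Representation 𝕜 (Equiv.Perm (Fin k)) (SpechtSpace 𝕜 k lam) where
  toFun g := ((tabloidRep 𝕜 k g).restrict (tabloidRep_mem_spechtSubmodule 𝕜 k lam g) :
    ↥(spechtSubmodule 𝕜 k lam) →ₗ[𝕜] ↥(spechtSubmodule 𝕜 k lam))
  map_one' := LinearMap.ext fun v => Subtype.ext (by
    change tabloidRep 𝕜 k 1 v.1 = v.1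
    rw [map_one]; rfl)
  map_mul' g h := LinearMap.ext fun v => Subtype.ext (by
    change tabloidRep 𝕜 k (g * h) v.1 = tabloidRep 𝕜 k g (tabloidRep 𝕜 k h v.1)
    rw [map_mul]; rfl)

/-! ### The simple modules of the dual symmetric inverse semigroup -/

section simpleModules

variable {X : Type*} {k : ℕ}

open DualSymInv

theorem GreenL.mul_ofPerm {ρ : Setoid X} {p : DualSymInv X} (hp : GreenL p (idem ρ))
    (g : Equiv.Perm (Quotient ρ)) : GreenL (p * ofPerm ρ g) (idem ρ) := by
  obtain ⟨⟨x, hx⟩, -⟩ := hp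
  refine ⟨⟨ofPerm ρ g⁻¹ * x, ?_⟩, ⟨p * ofPerm ρ g, ?_⟩⟩
  · rw [mul_assoc, ← mul_assoc x, hx, idem, ← ofPerm_mul, ← ofPerm_mul]
    simp
  · rw [idem, mul_assoc, ← ofPerm_mul, mul_one]

theorem LeftCell.mul_idem {ρ : Setoid X} (p : LeftCell (idem ρ)) : p.1 * idem ρ = p.1 := by
  obtain ⟨-, ⟨y, hy⟩⟩ := p.2
  rw [← hy, mul_assoc, idem, ← ofPerm_mul, mul_one]

/-- Right multiplication on the left cell of `idem ρ` by the element of the maximal subgroup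
given by the permutation `g` of the parts of `ρ`. -/
def LeftCell.mulPerm {ρ : Setoid X} (p : LeftCell (idem ρ)) (g : Equiv.Perm (Quotient ρ)) :
    LeftCell (idem ρ) :=
  ⟨p.1 * ofPerm ρ g, p.2.mul_ofPerm g⟩

/-- An enumeration `e` of the parts of `ρ` identifies the symmetric group of `Fin k` with
the maximal subgroup of `ρ`. Its right action on the linearized left cell of `idem ρ` is written
here as a left action, through `g ↦ g⁻¹`. -/
def rightRep (𝕜 : Type*) [CommRing 𝕜] {ρ : Setoid X} (e : Quotient ρ ≃ Fin k) :
    Representation 𝕜 (Equiv.Perm (Fin k)) (LeftCell (idem ρ) →₀ 𝕜) where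
  toFun g := Finsupp.lmapDomain 𝕜 𝕜 (fun p => p.mulPerm (e.symm.permCongr g⁻¹))
  map_one' := by
    ext p : 2
    simp only [LinearMap.comp_apply, Finsupp.lsingle_apply, Finsupp.lmapDomain_apply,
      Finsupp.mapDomain_single, Module.End.one_apply]
    congr 1
    refine Subtype.ext ?_
    have h : e.symm.permCongr (1 : Equiv.Perm (Fin k))⁻¹ = 1 := by ext; simp
    rw [LeftCell.mulPerm, h]
    exact p.mul_idem
  map_mul' s t := by
    ext p : 2
    simp only [LinearMap.comp_apply, Finsupp.lsingle_apply, Finsupp.lmapDomain_apply,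
      Finsupp.mapDomain_single, Module.End.mul_apply]
    congr 1
    refine Subtype.ext ?_
    have h : e.symm.permCongr (s * t)⁻¹ =
        e.symm.permCongr t⁻¹ * e.symm.permCongr s⁻¹ := by ext; simp
    simp only [LeftCell.mulPerm, h, ofPerm_mul, mul_assoc]

theorem cellRep_comm_rightRep (𝕜 : Type*) [CommRing 𝕜] {ρ : Setoid X} (e : Quotient ρ ≃ Fin k)
    (s : DualSymInv X) (g : Equiv.Perm (Fin k)) :
    cellRep 𝕜 (idem ρ) s ∘ₗ rightRep 𝕜 e g = rightRep 𝕜 e g ∘ₗ cellRep 𝕜 (idem ρ) s := by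
  ext p : 2
  simp only [LinearMap.comp_apply, Finsupp.lsingle_apply, cellRep, rightRep, MonoidHom.coe_mk,
    OneHom.coe_mk, Finsupp.lmapDomain_apply, Finsupp.mapDomain_single,
    Finsupp.linearCombination_single, one_smul, cellAct]
  set q := e.symm.permCongr g⁻¹ with hq
  have key : GreenL (s * (p.mulPerm q).1) (idem ρ) ↔ GreenL (s * p.1) (idem ρ) := by
    simp only [LeftCell.mulPerm, ← mul_assoc]
    refine ⟨fun h => ?_, fun h => h.mul_ofPerm q⟩
    have h2 := h.mul_ofPerm q⁻¹
    rwa [mul_assoc, ← ofPerm_mul, mul_inv_cancel, mul_assoc, ← idem, p.mul_idem] at h2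
  by_cases h : GreenL (s * p.1) (idem ρ)
  · rw [dif_pos h, dif_pos (key.2 h), Finsupp.mapDomain_single]
    congr 1
    exact Subtype.ext (mul_assoc _ _ _).symm
  · rw [dif_neg h, dif_neg (fun h' => h (key.1 h')), Finsupp.mapDomain_zero]

/-- The space `𝕜[L_ρ] ⊗_{𝕜[S_k]} S^lam`: the quotient of `𝕜[L_ρ] ⊗_𝕜 S^lam` by the span of
the `p g ⊗ v - p ⊗ g v`, i.e. the coinvariants of `g (p ⊗ v) = p g⁻¹ ⊗ g v`. -/
abbrev NSpace (𝕜 : Type*) [CommRing 𝕜] {ρ : Setoid X} (e : Quotient ρ ≃ Fin k)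
    (lam : YoungDiagram) : Type _ :=
  Representation.Coinvariants (V := (LeftCell (idem ρ) →₀ 𝕜) ⊗[𝕜] SpechtSpace 𝕜 k lam)
    ((rightRep 𝕜 e).tprod (specht 𝕜 k lam))

/-- The module `N^lam = 𝕜[L_ρ] ⊗_{𝕜[S_k]} S^lam` over the dual symmetric inverse semigroup,
for a set partition `ρ` with `k` parts (enumerated by `e`) and a partition `lam` of `k`. -/
def simpleRep (𝕜 : Type*) [CommRing 𝕜] {ρ : Setoid X} (e : Quotient ρ ≃ Fin k)
    (lam : YoungDiagram) : Representation 𝕜 (DualSymInv X) (NSpace 𝕜 e lam) where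
  toFun s := Representation.Coinvariants.map _ _
    ⟨(cellRep 𝕜 (idem ρ) s).rTensor _, fun g => by
      rw [Representation.tprod_apply, LinearMap.rTensor_comp_map, LinearMap.map_comp_rTensor,
        cellRep_comm_rightRep]⟩
  map_one' := by
    refine Representation.Coinvariants.hom_ext (LinearMap.ext fun v => ?_)
    simp [Representation.Coinvariants.map_mk, Module.End.one_eq_id]
  map_mul' s t := by
    refine Representation.Coinvariants.hom_ext (LinearMap.ext fun v => ?_)
    simp [Representation.Coinvariants.map_mk, LinearMap.rTensor_mul]

end simpleModules

/-! ### Multiplicities -/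

/-- The factor `s (i+1) / s i` of a composition series of submodules. -/
abbrev seriesFactor {A M : Type*} [Ring A] [AddCommGroup M] [Module A M]
    (s : CompositionSeries (Submodule A M)) (i : Fin s.length) : Type _ :=
  ↥(s i.succ) ⧸ (s i.castSucc).submoduleOf (s i.succ)

open Classical in
/-- The (Jordan–Hölder) multiplicity `[M : S]` of a simple module `S` in a module `M` of finite
length: the number of factors isomorphic to `S` in a composition series of `M`. -/
def compMultiplicity (A M S : Type*) [Ring A] [AddCommGroup M] [Module A M]
    [AddCommGroup S] [Module A S] : ℕ :=
  if h : ∃ s : CompositionSeries (Submodule A M), s.head = ⊥ ∧ s.last = ⊤ then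
    Nat.card {i : Fin h.choose.length // Nonempty (seriesFactor h.choose i ≃ₗ[A] S)}
  else 0

/-- The multiplicity of one representation in another one, as modules over the monoid algebra. -/
def repMultiplicity {𝕜 G V W : Type*} [CommRing 𝕜] [Monoid G] [AddCommGroup V] [Module 𝕜 V]
    [AddCommGroup W] [Module 𝕜 W] (V' : Representation 𝕜 G V) (W' : Representation 𝕜 G W) : ℕ :=
  compMultiplicity (MonoidAlgebra 𝕜 G) V'.asModule W'.asModule

/-! ### Matrices and the induction-restriction modules -/

/-- The set `Q^m_{k,l}` of `k × l` matrices with entries `0` and `1`, of which exactly `m` are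
equal to `1`, all of whose rows and columns are non-zero. -/
@[ext]
structure QMat (k l m : ℕ) where
  mat : Matrix (Fin k) (Fin l) (Fin 2)
  card_ones : Nat.card {p : Fin k × Fin l // mat p.1 p.2 = 1} = m
  row_ne_zero : ∀ i, ∃ j, mat i j = 1
  col_ne_zero : ∀ j, ∃ i, mat i j = 1

namespace QMat

variable {k l m : ℕ}

/-- The positions of the `1`-entries of a matrix. -/
abbrev Ones (M : QMat k l m) : Type := {p : Fin k × Fin l // M.mat p.1 p.2 = 1}

/-- `S_k × S_l` acts by independent permutations of the rows and of the columns. -/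
instance : MulAction (Equiv.Perm (Fin k) × Equiv.Perm (Fin l)) (QMat k l m) where
  smul g M :=
    { mat := fun i j => M.mat (g.1⁻¹ i) (g.2⁻¹ j)
      card_ones := (Nat.card_congr
        ((g.1⁻¹.prodCongr g.2⁻¹).subtypeEquiv fun p => Iff.rfl)).trans M.card_ones
      row_ne_zero := fun i => by
        obtain ⟨j, hj⟩ := M.row_ne_zero (g.1⁻¹ i)
        exact ⟨g.2 j, by simpa using hj⟩
      col_ne_zero := fun j => by
        obtain ⟨i, hi⟩ := M.col_ne_zero (g.2⁻¹ j)
        exact ⟨g.1 i, by simpa using hi⟩ }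
  one_smul M := rfl
  mul_smul g h M := by
    refine QMat.ext ?_
    funext i j
    change M.mat _ _ = M.mat _ _
    simp

theorem smul_apply (g : Equiv.Perm (Fin k) × Equiv.Perm (Fin l)) (M : QMat k l m)
    (i : Fin k) (j : Fin l) : (g • M).mat i j = M.mat (g.1⁻¹ i) (g.2⁻¹ j) := rfl

/-- The stabilizer of `M` in `S_k × S_l`. -/
abbrev Stab (M : QMat k l m) : Subgroup (Equiv.Perm (Fin k) × Equiv.Perm (Fin l)) :=
  MulAction.stabilizer _ M

theorem stab_apply {M : QMat k l m} (h : M.Stab) (i : Fin k) (j : Fin l) :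
    M.mat (h.1.1 i) (h.1.2 j) = M.mat i j := by
  have h1 := smul_apply h.1 M (h.1.1 i) (h.1.2 j)
  rw [MulAction.mem_stabilizer_iff.1 h.2] at h1
  simpa using h1

/-- The stabilizer of `M` permutes the `1`-entries of `M`. -/
def stabOnes (M : QMat k l m) : M.Stab →* Equiv.Perm M.Ones where
  toFun h := (h.1.1.prodCongr h.1.2).subtypeEquiv fun p => by
    change _ ↔ M.mat (h.1.1 p.1) (h.1.2 p.2) = 1
    rw [stab_apply]
  map_one' := rfl
  map_mul' _ _ := rfl

/-- The (injective) homomorphism from the stabilizer `H` of `M` to `S_m` given by a bijection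
`ψ` between `Fin m` and the set of `1`-entries of `M`; it identifies `H` with a subgroup
of `S_m`. -/
def stabHom (M : QMat k l m) (ψ : Fin m ≃ M.Ones) : M.Stab →* Equiv.Perm (Fin m) :=
  ψ.symm.permCongrHom.toMonoidHom.comp M.stabOnes

theorem stabHom_injective (M : QMat k l m) (ψ : Fin m ≃ M.Ones) :
    Function.Injective (M.stabHom ψ) := by
  intro g h hgh
  have h1 : M.stabOnes g = M.stabOnes h := ψ.symm.permCongrHom.injective hgh
  have h2 (p : M.Ones) : (g.1.1 p.1.1, g.1.2 p.1.2) = (h.1.1 p.1.1, h.1.2 p.1.2) :=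
    congrArg Subtype.val (Equiv.congr_fun h1 p)
  refine Subtype.ext (Prod.ext (Equiv.ext fun i => ?_) (Equiv.ext fun j => ?_))
  · obtain ⟨j, hj⟩ := M.row_ne_zero i
    exact (Prod.ext_iff.1 (h2 ⟨(i, j), hj⟩)).1
  · obtain ⟨i, hi⟩ := M.col_ne_zero j
    exact (Prod.ext_iff.1 (h2 ⟨(i, j), hi⟩)).2

end QMat

/-- The outer tensor product `S^lam ⊗ S^mu`, a module over `S_k × S_l`. -/
def spechtOuter (𝕜 : Type*) [CommRing 𝕜] (k l : ℕ) (lam mu : YoungDiagram) :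
    Representation 𝕜 (Equiv.Perm (Fin k) × Equiv.Perm (Fin l))
      (SpechtSpace 𝕜 k lam ⊗[𝕜] SpechtSpace 𝕜 l mu) :=
  Representation.tprod ((specht 𝕜 k lam).comp (MonoidHom.fst _ _))
    ((specht 𝕜 l mu).comp (MonoidHom.snd _ _))

/-- The restriction `Res_H (S^lam ⊗ S^mu)` to the stabilizer `H` of `M`. -/
def resStab (𝕜 : Type*) [CommRing 𝕜] {k l m : ℕ} (M : QMat k l m) (lam mu : YoungDiagram) :
    Representation 𝕜 M.Stab (SpechtSpace 𝕜 k lam ⊗[𝕜] SpechtSpace 𝕜 l mu) :=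
  (spechtOuter 𝕜 k l lam mu).comp M.Stab.subtype

/-- The module `Ind_H^{S_m} Res_H^{S_k × S_l} (S^lam ⊗ S^mu)`, where `H` is the stabilizer of
`M`, viewed as a subgroup of `S_m` through `ψ`. -/
def indRes (𝕜 : Type*) [CommRing 𝕜] {k l m : ℕ} (M : QMat k l m) (ψ : Fin m ≃ M.Ones)
    (lam mu : YoungDiagram) :
    Representation 𝕜 (Equiv.Perm (Fin m))
      (Representation.IndV (A := SpechtSpace 𝕜 k lam ⊗[𝕜] SpechtSpace 𝕜 l mu)
        (M.stabHom ψ) (resStab 𝕜 M lam mu)) :=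
  Representation.ind (M.stabHom ψ) (resStab 𝕜 M lam mu)

end

/-! Multiplicities are measured with idempotents. If `e` is an idempotent of a `𝕜`-algebra `B`, then
`V ↦ e V` is exact, so `dim e V` is additive along a composition series. If `S` is the only simple
module with `e S ≠ 0`, this gives `[V : S] * dim e S = dim e V` (`compMultiplicity_mul_finrank`).
For the symmetric group, Maschke's theorem and the simplicity of `S^ν` give an idempotent `ε` with
`S^ν` isomorphic to the left ideal generated by `ε`, and Schur's lemma shows that `ε` detects only
`S^ν`.

The idempotent `ε` is carried to the monoid algebra of `I_n^*`. The idempotents of set partitions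
commute and multiply by joins, so the product of `1 - e_σ` over all `σ` strictly coarser than `τ`,
times `e_τ`, is an idempotent `primIdem` that projects any module onto its `topVectors` at `τ`: the
vectors fixed by `e_τ` and killed by `e_σ` for every `σ > τ`. The maximal subgroup at `τ` acts on
them, and `liftIdem`, the product of the image of `ε` with `primIdem`, detects exactly `N^ν`
(`nonempty_linearEquiv_simpleRep`). The top vectors of `N^ν` itself are a copy of `S^ν`.

It remains to find the top vectors of `N^λ ⊗ N^μ` at `τ`. An element of a left cell is the same as a
surjection onto `Fin k`, and `ξ` either pushes this surjection forward or kills it. The tensor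
product is thus spanned by vectors indexed by pairs of surjections `(f, g)` with coefficients in the
Specht modules, and such a vector is fixed by `e_σ` if `σ ≤ ker f ⊓ ker g` and killed otherwise. So
`primIdem` keeps the pairs with `ker f ⊓ ker g = τ`. The joint image of such a pair is the set of
`1`-entries of a matrix in `Q_{k,l}^m`. Up to permutations of rows and columns it determines one `M
∈ C`, and the remaining freedom is the stabilizer of `M`. Hence the top vectors form the product
over `M ∈ C` of the induced modules (`exists_indProd_equiv_topVectors`). Comparing dimensions and
cancelling `dim ε S^ν` gives the formula. -/

noncomputable section

/-! ### Multiplicities through idempotents -/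

section FixedVectors

variable (𝕜 : Type*) {B : Type*} [Field 𝕜] [Ring B] [Algebra 𝕜 B] (e : B)

/-- The subspace of the vectors of a module that are fixed by an element of the ring. -/
def fixedVectors (M : Type*) [AddCommGroup M] [Module 𝕜 M] [Module B M] [IsScalarTower 𝕜 B M] :
    Submodule 𝕜 M where
  carrier := {v | e • v = v}
  add_mem' {a b} ha hb := by
    change e • (a + b) = a + b
    rw [smul_add, show e • a = a from ha, show e • b = b from hb]
  zero_mem' := smul_zero e
  smul_mem' c v hv := by
    have : SMulCommClass 𝕜 B M := IsScalarTower.to_smulCommClass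
    change e • c • v = c • v
    rw [smul_comm, show e • v = v from hv]

variable {M M' : Type*} [AddCommGroup M] [Module 𝕜 M] [Module B M] [IsScalarTower 𝕜 B M]
  [AddCommGroup M'] [Module 𝕜 M'] [Module B M'] [IsScalarTower 𝕜 B M']

theorem mem_fixedVectors {v : M} : v ∈ fixedVectors 𝕜 e M ↔ e • v = v := Iff.rfl

/-- A homomorphism of modules maps fixed vectors to fixed vectors. -/
def fixedVectorsMap (f : M →ₗ[B] M') : fixedVectors 𝕜 e M →ₗ[𝕜] fixedVectors 𝕜 e M' :=
  (f.restrictScalars 𝕜).restrict fun v hv => by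
    rw [mem_fixedVectors] at hv ⊢
    rw [LinearMap.restrictScalars_apply, ← map_smul, hv]

theorem finrank_fixedVectors_congr (f : M ≃ₗ[B] M') :
    Module.finrank 𝕜 (fixedVectors 𝕜 e M) = Module.finrank 𝕜 (fixedVectors 𝕜 e M') := by
  refine LinearEquiv.finrank_eq (LinearEquiv.ofLinearMap (fixedVectorsMap 𝕜 e f.toLinearMap)
    (fixedVectorsMap 𝕜 e f.symm.toLinearMap) ?_ ?_)
  · ext v
    exact f.apply_symm_apply v.1
  · ext v
    exact f.symm_apply_apply v.1

/-- Taking fixed vectors of an idempotent is exact: a fixed vector `q` of the quotient with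
representative `v` lifts to the fixed vector `e • v`. The rest is rank-nullity. -/
theorem finrank_fixedVectors_quotient {e : B} (he : IsIdempotentElem e) [FiniteDimensional 𝕜 M]
    (N : Submodule B M) :
    Module.finrank 𝕜 (fixedVectors 𝕜 e M) =
      Module.finrank 𝕜 (fixedVectors 𝕜 e N) + Module.finrank 𝕜 (fixedVectors 𝕜 e (M ⧸ N)) := by
  rw [← LinearMap.finrank_range_add_finrank_ker (fixedVectorsMap 𝕜 e N.mkQ), add_comm]
  congr 1
  · refine LinearEquiv.finrank_eq (LinearEquiv.symm (LinearEquiv.ofBijective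
      ((fixedVectorsMap 𝕜 e N.subtype).codRestrict _ fun v => ?_) ⟨?_, ?_⟩))
    · rw [LinearMap.mem_ker]
      exact Subtype.ext ((Submodule.Quotient.mk_eq_zero N).2 v.1.2)
    · intro v w h
      exact Subtype.ext (Subtype.ext (congrArg (fun x => x.1.1) h))
    · rintro ⟨⟨v, hv⟩, hv'⟩
      have hN : v ∈ N := (Submodule.Quotient.mk_eq_zero N).1
        (congrArg Subtype.val (LinearMap.mem_ker.1 hv'))
      exact ⟨⟨⟨v, hN⟩, Subtype.ext hv⟩, rfl⟩
  · have : Function.Surjective (fixedVectorsMap 𝕜 e N.mkQ) := by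
      rintro ⟨q, hq⟩
      obtain ⟨v, rfl⟩ := N.mkQ_surjective q
      refine ⟨⟨e • v, ?_⟩, Subtype.ext ?_⟩
      · rw [mem_fixedVectors, smul_smul, he]
      · exact (map_smul N.mkQ e v).trans hq
    rw [LinearMap.range_eq_top.2 this, finrank_top]

/-- If an idempotent `e` detects the simple module `S` among the simple modules, then the
multiplicity of `S` can be read off from the dimensions of the spaces of vectors fixed by `e`. -/
theorem compMultiplicity_mul_finrank.{u} {e : B} (he : IsIdempotentElem e) {M : Type u}
    [AddCommGroup M] [Module 𝕜 M] [Module B M] [IsScalarTower 𝕜 B M] [FiniteDimensional 𝕜 M]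
    {S : Type*} [AddCommGroup S] [Module 𝕜 S] [Module B S] [IsScalarTower 𝕜 B S]
    (h : ∀ (Q : Type u) [AddCommGroup Q] [Module 𝕜 Q] [Module B Q] [IsScalarTower 𝕜 B Q]
      [IsSimpleModule B Q], fixedVectors 𝕜 e Q ≠ ⊥ → Nonempty (Q ≃ₗ[B] S)) :
    compMultiplicity B M S * Module.finrank 𝕜 (fixedVectors 𝕜 e S) =
      Module.finrank 𝕜 (fixedVectors 𝕜 e M) := by
  classical
  have : IsNoetherian B M := isNoetherian_of_tower 𝕜 inferInstance
  have : IsArtinian B M := isArtinian_of_tower 𝕜 inferInstance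
  have hex := exists_compositionSeries_of_isNoetherian_isArtinian B M
  rw [compMultiplicity, dif_pos hex]
  set s := hex.choose
  obtain ⟨hhead, hlast⟩ : s.head = ⊥ ∧ s.last = ⊤ := hex.choose_spec
  -- Additivity along the series: the factor with index `j` lies below `s i` exactly when
  -- `j.castSucc < i`, so the last index collects all factors.
  have key (i : Fin (s.length + 1)) : Module.finrank 𝕜 (fixedVectors 𝕜 e (s i)) =
      ∑ j : Fin s.length with j.castSucc < i,
        Module.finrank 𝕜 (fixedVectors 𝕜 e (seriesFactor s j)) := by
    induction i using Fin.induction with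
    | zero =>
      have h0 : s 0 = ⊥ := hhead
      have : Subsingleton (s 0) := by rw [h0]; infer_instance
      rw [Module.finrank_zero_of_subsingleton, Finset.filter_false_of_mem, Finset.sum_empty]
      exact fun j _ => by simp
    | succ i ih =>
      have hle : s i.castSucc ≤ s i.succ := (s.step i).le
      have : FiniteDimensional 𝕜 (s i.succ) :=
        inferInstanceAs (FiniteDimensional 𝕜 ((s i.succ).restrictScalars 𝕜))
      rw [finrank_fixedVectors_quotient 𝕜 he ((s i.castSucc).submoduleOf (s i.succ)),
        finrank_fixedVectors_congr 𝕜 e (Submodule.submoduleOfEquivOfLe hle), ih,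
        show (Finset.univ.filter fun j : Fin s.length => j.castSucc < i.succ) =
          insert i (Finset.univ.filter fun j : Fin s.length => j.castSucc < i.castSucc) by
            ext j
            simp only [Finset.mem_filter, Finset.mem_univ, true_and, Finset.mem_insert,
              Fin.lt_def, Fin.ext_iff, Fin.val_castSucc, Fin.val_succ]
            omega,
        Finset.sum_insert (by simp), add_comm]
  have htop : Module.finrank 𝕜 (fixedVectors 𝕜 e M) =
      Module.finrank 𝕜 (fixedVectors 𝕜 e (s (Fin.last _))) := by
    have hl : s (Fin.last _) = ⊤ := hlast
    rw [hl]
    exact finrank_fixedVectors_congr 𝕜 e Submodule.topEquiv.symm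
  rw [htop, key, Finset.filter_true_of_mem (fun j _ => Fin.castSucc_lt_last j),
    Nat.card_eq_fintype_card, Fintype.card_subtype, ← smul_eq_mul, ← Finset.sum_const,
    Finset.sum_filter]
  refine Finset.sum_congr rfl fun j _ => ?_
  split_ifs with hj
  · exact (finrank_fixedVectors_congr 𝕜 e hj.some).symm
  -- A factor that is not isomorphic to `S` is still simple, so it has no nonzero fixed vectors and
  -- contributes nothing.
  · by_contra h0
    have : IsSimpleModule B (seriesFactor s j) :=
      (covBy_iff_quot_is_simple (s.step j).le).1 (s.step j)
    refine hj (h (seriesFactor s j) fun hbot => h0 ?_)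
    exact ((congrArg (fun W : Submodule 𝕜 (seriesFactor s j) => Module.finrank 𝕜 W) hbot).trans
      (finrank_bot 𝕜 _)).symm

theorem IsSemisimpleRing.exists_idempotent_of_isSimpleModule [IsSemisimpleRing B]
    [IsSimpleModule B M] :
    ∃ e : B, IsIdempotentElem e ∧ Nonempty (M ≃ₗ[B] Ideal.span {e}) := by
  obtain ⟨I, ⟨θ⟩⟩ := IsSemisimpleRing.exists_linearEquiv_ideal_of_isSimpleModule B M
  obtain ⟨e, he, rfl⟩ := IsSemisimpleRing.ideal_eq_span_idempotent I
  exact ⟨e, he, ⟨θ⟩⟩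

/-- The generator `e` of the left ideal is fixed by `e`. This makes the dimension that is cancelled
at the end nonzero. -/
theorem fixedVectors_ne_bot_of_linearEquiv_span {e : B} (he : IsIdempotentElem e)
    [Nontrivial M] (θ : M ≃ₗ[B] Ideal.span {e}) : fixedVectors 𝕜 e M ≠ ⊥ := by
  intro h
  have hmem : e ∈ Ideal.span {e} := Ideal.mem_span_singleton_self e
  have h1 : θ.symm ⟨e, hmem⟩ ∈ fixedVectors 𝕜 e M := by
    rw [mem_fixedVectors, ← map_smul]
    exact congrArg θ.symm (Subtype.ext he)
  rw [h, Submodule.mem_bot, LinearEquiv.map_eq_zero_iff] at h1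
  have h2 : e = 0 := congrArg Subtype.val h1
  have : Subsingleton M := by
    refine (θ.toEquiv.subsingleton_congr).2 ⟨fun a b => ?_⟩
    have hz (c : Ideal.span {e}) : c.1 = 0 := by
      obtain ⟨d, hd⟩ := Ideal.mem_span_singleton'.1 c.2
      rw [← hd, h2, mul_zero]
    exact Subtype.ext ((hz a).trans (hz b).symm)
  exact not_subsingleton M this

end FixedVectors

/-- A nonzero vector `w` fixed by `e` gives the nonzero homomorphism `x ↦ x • w` on the left ideal
of `e`, and Schur's lemma applies. -/
theorem nonempty_linearEquiv_of_fixedVectors_ne_bot {𝕜 B M M' : Type*} [Field 𝕜] [Ring B]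
    [Algebra 𝕜 B] [AddCommGroup M] [Module B M] [AddCommGroup M'] [Module 𝕜 M'] [Module B M']
    [IsScalarTower 𝕜 B M'] {e : B} [IsSimpleModule B M] [IsSimpleModule B M']
    (θ : M ≃ₗ[B] Ideal.span {e})
    (h : fixedVectors 𝕜 e M' ≠ ⊥) : Nonempty (M' ≃ₗ[B] M) := by
  obtain ⟨w, hw, hw0⟩ := Submodule.exists_mem_ne_zero_of_ne_bot h
  let f : M →ₗ[B] M' := (LinearMap.toSpanSingleton B M' w) ∘ₗ (Ideal.span {e}).subtype ∘ₗ
    θ.toLinearMap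
  have hf : f ≠ 0 := by
    intro h0
    have := LinearMap.congr_fun h0 (θ.symm ⟨e, Ideal.mem_span_singleton_self e⟩)
    simp only [f, LinearMap.comp_apply, LinearEquiv.coe_coe, LinearEquiv.apply_symm_apply,
      Submodule.subtype_apply, LinearMap.toSpanSingleton_apply, LinearMap.zero_apply] at this
    exact hw0 (hw.symm.trans this)
  exact ⟨(LinearEquiv.ofBijective f (LinearMap.bijective_of_ne_zero hf)).symm⟩

/-! ### Simplicity of the Specht modules -/

namespace Tableau

variable {lam : YoungDiagram} {k : ℕ}

/-- The column stabilizer of a tableau. -/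
def colStab (t : Tableau lam k) : Finset (Equiv.Perm (Fin k)) :=
  Finset.univ.filter fun σ => ∀ i, t.col (σ i) = t.col i

theorem mem_colStab {t : Tableau lam k} {σ : Equiv.Perm (Fin k)} :
    σ ∈ t.colStab ↔ ∀ i, t.col (σ i) = t.col i := by
  simp [colStab]

theorem one_mem_colStab (t : Tableau lam k) : 1 ∈ t.colStab := by
  simp [mem_colStab]

theorem mul_mem_colStab {t : Tableau lam k} {σ θ : Equiv.Perm (Fin k)} (hσ : σ ∈ t.colStab)
    (hθ : θ ∈ t.colStab) : σ * θ ∈ t.colStab := by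
  rw [mem_colStab] at *
  intro i
  rw [Equiv.Perm.mul_apply, hσ, hθ]

theorem inv_mem_colStab {t : Tableau lam k} {σ : Equiv.Perm (Fin k)} (hσ : σ ∈ t.colStab) :
    σ⁻¹ ∈ t.colStab := by
  rw [mem_colStab] at *
  intro i
  simpa using (hσ (σ⁻¹ i)).symm

theorem eq_of_row_eq_of_col_eq (t : Tableau lam k) {i j : Fin k} (hr : t.row i = t.row j)
    (hc : t.col i = t.col j) : i = j :=
  t.symm.injective (Subtype.ext (Prod.ext hr hc))

/-- If the entries in each column of `t` lie in distinct rows of `s`, then the entries of `t` can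
be permuted within the columns so that they are in the same rows as in `s`. -/
theorem exists_row_eq (s t : Tableau lam k)
    (h : ∀ a b, t.col a = t.col b → s.row a = s.row b → a = b) :
    ∃ σ ∈ t.colStab, ∀ i, s.row i = t.row (σ⁻¹ i) := by
  classical
  -- Within each column of `t` the entries are to be sorted by their rows in `s`; `r x` is the row
  -- that `x` then gets. It is at most `s.row x` because the entries of the column lie in distinct
  -- rows of `s`.
  let B (x : Fin k) : Finset (Fin k) :=
    Finset.univ.filter fun y => t.col y = t.col x ∧ s.row y < s.row x
  let r (x : Fin k) : ℕ := (B x).card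
  have hr_le (x : Fin k) : r x ≤ s.row x := by
    refine (Finset.card_le_card_of_injOn (t := Finset.range (s.row x)) s.row ?_ ?_).trans_eq
      (Finset.card_range _)
    · intro y hy
      simp only [B, Finset.coe_filter, Set.mem_ofPred_eq, Finset.mem_univ, true_and] at hy
      simpa using hy.2
    · intro y hy z hz hyz
      simp only [B, Finset.coe_filter, Set.mem_ofPred_eq, Finset.mem_univ, true_and] at hy hz
      exact h y z (hy.1.trans hz.1.symm) hyz
  have hr_lt {x y : Fin k} (hc : t.col x = t.col y) (hxy : s.row x < s.row y) : r x < r y := by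
    refine Finset.card_lt_card ((Finset.ssubset_iff_of_subset fun z hz => ?_).2 ⟨x, ?_, ?_⟩)
    · simp only [B, Finset.mem_filter, Finset.mem_univ, true_and] at hz ⊢
      exact ⟨hz.1.trans hc, hz.2.trans hxy⟩
    · simp [B, hc, hxy]
    · simp [B]
  have hcell (x : Fin k) : (r x, t.col x) ∈ lam.cells := by
    have h1 : r x < lam.colLen (t.col x) := by
      have hsub : (B x) ⊂ Finset.univ.filter fun y => t.col y = t.col x := by
        refine (Finset.ssubset_iff_of_subset fun z hz => ?_).2 ⟨x, ?_, ?_⟩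
        · simp only [B, Finset.mem_filter, Finset.mem_univ, true_and] at hz ⊢
          exact hz.1
        · simp
        · simp [B]
      refine (Finset.card_lt_card hsub).trans_le ?_
      refine (Finset.card_le_card_of_injOn (t := Finset.range (lam.colLen (t.col x)))
        t.row ?_ ?_).trans_eq (Finset.card_range _)
      · intro y hy
        simp only [Finset.coe_filter, Set.mem_ofPred_eq, Finset.mem_univ, true_and] at hy
        rw [Finset.coe_range, Set.mem_Iio, ← YoungDiagram.mem_iff_lt_colLen, ← hy]
        exact (t.symm y).2
      · intro y hy z hz hyz
        simp only [Finset.coe_filter, Set.mem_ofPred_eq, Finset.mem_univ, true_and] at hy hz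
        exact t.eq_of_row_eq_of_col_eq hyz (hy.trans hz.symm)
    exact YoungDiagram.mem_iff_lt_colLen.2 h1
  let w (x : Fin k) : lam.cells := ⟨(r x, t.col x), hcell x⟩
  have hw : Function.Injective w := by
    intro x y hxy
    have h1 : r x = r y := congrArg (fun c => c.1.1) hxy
    have h2 : t.col x = t.col y := congrArg (fun c => c.1.2) hxy
    rcases lt_trichotomy (s.row x) (s.row y) with h3 | h3 | h3
    · exact absurd h1 (hr_lt h2 h3).ne
    · exact h x y h2 h3
    · exact absurd h1 (hr_lt h2.symm h3).ne'
  have hw' : Function.Bijective w :=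
    (Fintype.bijective_iff_injective_and_card w).2 ⟨hw, (Fintype.card_congr t).symm⟩
  -- Both sides are the sum of the row indices of all cells of `lam`, so the inequalities `r x ≤
  -- s.row x` are all equalities.
  have hsum : ∑ x, r x = ∑ x, s.row x :=
    (hw'.sum_comp fun c : lam.cells => c.1.1).trans
      (s.symm.bijective.sum_comp fun c : lam.cells => c.1.1).symm
  have heq (x : Fin k) : r x = s.row x :=
    (Finset.sum_eq_sum_iff_of_le fun i _ => hr_le i).1 hsum x (Finset.mem_univ x)
  let σ : Equiv.Perm (Fin k) := ((Equiv.ofBijective w hw').trans t)⁻¹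
  have hσ (i : Fin k) : t.symm (σ⁻¹ i) = w i := by simp [σ]
  refine ⟨σ, ?_, fun i => ?_⟩
  · rw [← inv_inv σ]
    refine inv_mem_colStab (mem_colStab.2 fun i => ?_)
    rw [col, hσ]
  · exact (heq i).symm.trans (congrArg (fun c => c.1.1) (hσ i)).symm

variable (𝕜 : Type*) [Field 𝕜]

theorem polytabloid_eq (t : Tableau lam k) : t.polytabloid 𝕜 = ∑ σ ∈ t.colStab,
    Finsupp.single (fun i => t.row (σ⁻¹ i)) ((Equiv.Perm.sign σ : ℤ) : 𝕜) := rfl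

/-- The signed sum of the column stabilizer of a tableau. -/
def antisymmetrizer (t : Tableau lam k) : Module.End 𝕜 ((Fin k → ℕ) →₀ 𝕜) :=
  ∑ σ ∈ t.colStab, ((Equiv.Perm.sign σ : ℤ) : 𝕜) • tabloidRep 𝕜 k σ

theorem antisymmetrizer_single (t : Tableau lam k) (f : Fin k → ℕ) :
    t.antisymmetrizer 𝕜 (Finsupp.single f 1) = ∑ σ ∈ t.colStab,
      Finsupp.single (fun i => f (σ⁻¹ i)) ((Equiv.Perm.sign σ : ℤ) : 𝕜) := by
  simp [antisymmetrizer, LinearMap.sum_apply, tabloidRep]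

theorem antisymmetrizer_single_of_mem (t : Tableau lam k) {σ : Equiv.Perm (Fin k)}
    (hσ : σ ∈ t.colStab) :
    t.antisymmetrizer 𝕜 (Finsupp.single (fun i => t.row (σ⁻¹ i)) 1) =
      ((Equiv.Perm.sign σ : ℤ) : 𝕜) • t.polytabloid 𝕜 := by
  rw [antisymmetrizer_single, polytabloid_eq, Finset.smul_sum]
  refine Finset.sum_bij' (fun θ _ => θ * σ) (fun θ _ => θ * σ⁻¹) ?_ ?_ ?_ ?_ ?_
  · exact fun θ hθ => mul_mem_colStab hθ hσ
  · exact fun θ hθ => mul_mem_colStab hθ (inv_mem_colStab hσ)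
  · intro θ _; group
  · intro θ _; group
  · intro θ _
    rw [Finsupp.smul_single, smul_eq_mul, ← Int.cast_mul, ← Units.val_mul, Equiv.Perm.sign_mul,
      mul_comm, mul_assoc, Int.units_mul_self, mul_one]
    simp [mul_inv_rev]

/-- Either no two entries share a column of `t` and a row of `s`, and then the tabloid of `s` is a
column permutation of that of `t`; or two such entries exist, and their transposition pairs off
terms of opposite sign, so that `c = 0`. -/
theorem antisymmetrizer_single_row (s t : Tableau lam k) :
    ∃ c : 𝕜, t.antisymmetrizer 𝕜 (Finsupp.single s.row 1) = c • t.polytabloid 𝕜 := by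
  by_cases h : ∀ a b, t.col a = t.col b → s.row a = s.row b → a = b
  · obtain ⟨σ, hσ, h1⟩ := exists_row_eq s t h
    rw [show s.row = fun i => t.row (σ⁻¹ i) from funext h1]
    exact ⟨_, t.antisymmetrizer_single_of_mem 𝕜 hσ⟩
  · push Not at h
    obtain ⟨a, b, hc, hr, hab⟩ := h
    refine ⟨0, ?_⟩
    rw [zero_smul, antisymmetrizer_single]
    have hsw : Equiv.swap a b ∈ t.colStab := by
      rw [mem_colStab]
      intro i
      by_cases hia : i = a
      · rw [hia, Equiv.swap_apply_left, hc]
      · by_cases hib : i = b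
        · rw [hib, Equiv.swap_apply_right, hc]
        · rw [Equiv.swap_apply_of_ne_of_ne hia hib]
    have hrow (i : Fin k) : s.row (Equiv.swap a b i) = s.row i := by
      by_cases hia : i = a
      · rw [hia, Equiv.swap_apply_left, hr]
      · by_cases hib : i = b
        · rw [hib, Equiv.swap_apply_right, hr]
        · rw [Equiv.swap_apply_of_ne_of_ne hia hib]
    refine Finset.sum_involution (fun σ _ => σ * Equiv.swap a b) ?_ ?_ ?_ ?_
    · intro σ _
      rw [Equiv.Perm.sign_mul, Equiv.Perm.sign_swap hab]
      simp [mul_inv_rev, hrow]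
    · intro σ _ _ h
      exact hab (Equiv.swap_eq_one_iff.1 (mul_eq_left.1 h))
    · exact fun σ hσ => mul_mem_colStab hσ hsw
    · intro σ _
      simp [mul_assoc]

theorem antisymmetrizer_of_mem (t : Tableau lam k) {v : (Fin k → ℕ) →₀ 𝕜}
    (hv : v ∈ spechtSubmodule 𝕜 k lam) :
    ∃ c : 𝕜, t.antisymmetrizer 𝕜 v = c • t.polytabloid 𝕜 := by
  have h : spechtSubmodule 𝕜 k lam ≤
      (Submodule.span 𝕜 {t.polytabloid 𝕜}).comap (t.antisymmetrizer 𝕜) := by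
    refine Submodule.span_le.2 ?_
    rintro _ ⟨s, rfl⟩
    rw [polytabloid_eq]
    refine Submodule.sum_mem _ fun σ _ => ?_
    rw [← mul_one (((Equiv.Perm.sign σ : ℤ) : 𝕜)), ← smul_eq_mul, ← Finsupp.smul_single]
    refine Submodule.smul_mem _ _ ?_
    obtain ⟨c, hc⟩ := antisymmetrizer_single_row 𝕜 (s.trans σ) t
    exact Submodule.mem_span_singleton.2 ⟨c, hc.symm⟩
  obtain ⟨c, hc⟩ := Submodule.mem_span_singleton.1 (h hv)
  exact ⟨c, hc.symm⟩

/-- Each signed tabloid in the polytabloid contributes the polytabloid once, the two signs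
cancelling. -/
theorem antisymmetrizer_polytabloid (t : Tableau lam k) :
    t.antisymmetrizer 𝕜 (t.polytabloid 𝕜) = (t.colStab.card : 𝕜) • t.polytabloid 𝕜 := by
  conv_lhs => rw [polytabloid_eq, map_sum]
  rw [Finset.sum_congr rfl (g := fun _ => t.polytabloid 𝕜), Finset.sum_const,
    Nat.cast_smul_eq_nsmul]
  intro σ hσ
  rw [← mul_one (((Equiv.Perm.sign σ : ℤ) : 𝕜)), ← smul_eq_mul, ← Finsupp.smul_single, map_smul,
    antisymmetrizer_single_of_mem 𝕜 t hσ, smul_smul, ← Int.cast_mul, ← Units.val_mul,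
    Int.units_mul_self]
  simp

/-- The tabloid of `t` has coefficient `1`: a permutation that preserves both the row and the column
of every entry is the identity. -/
theorem polytabloid_ne_zero (t : Tableau lam k) : t.polytabloid 𝕜 ≠ 0 := by
  intro h
  have h1 := DFunLike.congr_fun h t.row
  rw [polytabloid_eq, Finsupp.finsetSum_apply, Finset.sum_eq_single 1] at h1
  · simp at h1
  · intro σ hσ hσ1
    refine Finsupp.single_eq_of_ne fun h2 => hσ1 ?_
    have h3 : σ⁻¹ = 1 := by
      ext i
      rw [t.eq_of_row_eq_of_col_eq (i := σ⁻¹ i) (j := i) ?_ ?_]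
      · rfl
      · exact (congrFun h2 i).symm
      · exact mem_colStab.1 (inv_mem_colStab hσ) i
    exact inv_eq_one.1 h3
  · exact fun h => absurd t.one_mem_colStab h

end Tableau

section SpechtSimple

variable (𝕜 : Type*) [Field 𝕜] {k : ℕ} {lam : YoungDiagram}

/-- A polytabloid as an element of the Specht module. -/
def spechtPolytabloid (t : Tableau lam k) : (specht 𝕜 k lam).asModule :=
  (⟨t.polytabloid 𝕜, Submodule.subset_span ⟨t, rfl⟩⟩ : ↥(spechtSubmodule 𝕜 k lam))

theorem spechtPolytabloid_trans (t : Tableau lam k) (g : Equiv.Perm (Fin k)) :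
    spechtPolytabloid 𝕜 (t.trans g) = MonoidAlgebra.single g (1 : 𝕜) • spechtPolytabloid 𝕜 t := by
  rw [Representation.single_smul, one_smul]
  exact Subtype.ext (tabloidRep_polytabloid 𝕜 t g).symm

/-- The symmetric group permutes the tableaux of a given shape transitively, so any one polytabloid
generates the Specht module. -/
theorem specht_submodule_eq_top {t : Tableau lam k}
    {N : Submodule (MonoidAlgebra 𝕜 (Equiv.Perm (Fin k))) (specht 𝕜 k lam).asModule}
    (h : spechtPolytabloid 𝕜 t ∈ N) : N = ⊤ := by
  rw [eq_top_iff]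
  rintro ⟨v, hv⟩ -
  induction hv using Submodule.span_induction with
  | mem x hx =>
    obtain ⟨s, rfl⟩ := hx
    have h1 : t.trans (t.symm.trans s) = s := by ext; simp
    have h2 := N.smul_mem (MonoidAlgebra.single (t.symm.trans s) (1 : 𝕜)) h
    rw [← spechtPolytabloid_trans, h1] at h2
    exact h2
  | zero => exact N.zero_mem
  | add x y hx hy h1 h2 => exact N.add_mem h1 h2
  | smul a x hx h1 => exact (N.restrictScalars 𝕜).smul_mem a h1

/-- The signed column sum `a` maps the whole module into the line of the polytabloid and acts on
that line by a nonzero scalar. Split the polytabloid along `N` and a complement given by Maschke's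
theorem: the scalars that `a` produces from the two components have a nonzero sum, so one of the two
submodules contains the polytabloid and is everything. -/
theorem specht_isSimpleModule [CharZero 𝕜] (hlam : lam.card = k) :
    IsSimpleModule (MonoidAlgebra 𝕜 (Equiv.Perm (Fin k))) (specht 𝕜 k lam).asModule := by
  have : NeZero (Nat.card (Equiv.Perm (Fin k)) : 𝕜) :=
    ⟨by simp⟩
  let t : Tableau lam k := Finset.equivFinOfCardEq hlam
  have hne : spechtPolytabloid 𝕜 t ≠ 0 := fun h =>
    t.polytabloid_ne_zero 𝕜 (congrArg Subtype.val h)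
  let a : MonoidAlgebra 𝕜 (Equiv.Perm (Fin k)) :=
    ∑ σ ∈ t.colStab, MonoidAlgebra.single σ ((Equiv.Perm.sign σ : ℤ) : 𝕜)
  have ha (x : (specht 𝕜 k lam).asModule) :
      (show ↥(spechtSubmodule 𝕜 k lam) from a • x).1 =
        t.antisymmetrizer 𝕜 (show ↥(spechtSubmodule 𝕜 k lam) from x).1 := by
    simp only [a, Finset.sum_smul, Tableau.antisymmetrizer, LinearMap.sum_apply,
      Representation.single_smul]
    exact map_sum (spechtSubmodule 𝕜 k lam).subtype _ _
  have ha' (x : (specht 𝕜 k lam).asModule) : ∃ c : 𝕜, a • x = c • spechtPolytabloid 𝕜 t := by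
    obtain ⟨c, hc⟩ := t.antisymmetrizer_of_mem 𝕜 (show ↥(spechtSubmodule 𝕜 k lam) from x).2
    exact ⟨c, Subtype.ext ((ha x).trans hc)⟩
  have hmem {N : Submodule (MonoidAlgebra 𝕜 (Equiv.Perm (Fin k))) (specht 𝕜 k lam).asModule}
      {x : (specht 𝕜 k lam).asModule} (hx : x ∈ N) {c : 𝕜} (hc : c ≠ 0)
      (h : a • x = c • spechtPolytabloid 𝕜 t) : N = ⊤ := by
    refine specht_submodule_eq_top 𝕜 (t := t) ?_
    rw [← inv_smul_smul₀ hc (spechtPolytabloid 𝕜 t), ← h]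
    exact (N.restrictScalars 𝕜).smul_mem _ (N.smul_mem a hx)
  have : Nontrivial (specht 𝕜 k lam).asModule := ⟨_, _, hne⟩
  rw [isSimpleModule_iff]
  refine { eq_bot_or_eq_top := fun N => ?_ }
  obtain ⟨N', hN'⟩ := MonoidAlgebra.Submodule.exists_isCompl N
  obtain ⟨u, hu, u', hu', huu⟩ := Submodule.mem_sup.1
    (hN'.sup_eq_top ▸ Submodule.mem_top : spechtPolytabloid 𝕜 t ∈ N ⊔ N')
  obtain ⟨c, hc⟩ := ha' u
  obtain ⟨c', hc'⟩ := ha' u'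
  have hsum : (c + c') • spechtPolytabloid 𝕜 t = (t.colStab.card : 𝕜) • spechtPolytabloid 𝕜 t := by
    rw [add_smul, ← hc, ← hc', ← smul_add, huu]
    exact Subtype.ext ((ha _).trans (t.antisymmetrizer_polytabloid 𝕜))
  have hcard : (t.colStab.card : 𝕜) ≠ 0 :=
    Nat.cast_ne_zero.2 (Finset.card_ne_zero_of_mem t.one_mem_colStab)
  have hcc : c + c' = t.colStab.card := smul_left_injective 𝕜 hne hsum
  by_cases h0 : c = 0
  · have h1 : c' ≠ 0 := by rw [h0, zero_add] at hcc; rwa [hcc]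
    left
    have := hmem hu' h1 hc'
    subst this
    exact eq_bot_of_isCompl_top hN'
  · exact Or.inr (hmem hu h0 hc)

end SpechtSimple

/-! ### Multiplication in the dual symmetric inverse semigroup -/

namespace DualSymInv

variable {X : Type*}

theorem rel_idem {σ : Setoid X} {x y : X} : (idem σ).rel x y ↔ σ x y :=
  Quotient.eq (r := σ)

theorem dom_le_dom_mul (ξ ζ : DualSymInv X) : ζ.dom ≤ (ξ * ζ).dom := by
  intro x x' h
  obtain ⟨y, hy, hy'⟩ := (ζ.dom_iff x x').1 h
  obtain ⟨z, hz⟩ := ξ.exists_rel_right y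
  exact ((ξ * ζ).dom_iff x x').2 ⟨z, rel_mul_of_rel hy hz, rel_mul_of_rel hy' hz⟩

theorem rel_of_dom {ξ : DualSymInv X} {x x' y : X} (h : ξ.dom x x') (h' : ξ.rel x' y) :
    ξ.rel x y := by
  rw [rel, Quotient.sound h]
  exact h'

theorem mul_idem_of_le {ξ : DualSymInv X} {σ : Setoid X} (h : σ ≤ ξ.dom) :
    ξ * idem σ = ξ := by
  refine ext_rel fun x y => ⟨fun hxy => ?_, fun hxy => ?_⟩
  · exact rel_mul_min (rel_difunctional _)
      (fun u v w huv hvw => rel_of_dom (h (rel_idem.1 huv)) hvw) hxy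
  · exact rel_mul_of_rel (rel_idem.2 (σ.refl x)) hxy

theorem idem_mul_idem (σ θ : Setoid X) : idem σ * idem θ = idem (σ ⊔ θ) := by
  have hrefl (x : X) : (idem σ * idem θ).rel x x :=
    rel_mul_of_rel (rel_idem.2 (θ.refl x)) (rel_idem.2 (σ.refl x))
  refine ext_rel fun x y => ⟨fun hxy => ?_, fun hxy => ?_⟩
  · refine rel_mul_min (rel_difunctional _) (fun u v w huv hvw => ?_) hxy
    exact rel_idem.2 ((σ ⊔ θ).trans ((le_sup_right : θ ≤ σ ⊔ θ) (rel_idem.1 huv))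
      ((le_sup_left : σ ≤ σ ⊔ θ) (rel_idem.1 hvw)))
  · have h : σ ⊔ θ ≤ (idem σ * idem θ).dom := by
      refine sup_le (fun u v huv => ?_) (dom_le_dom_mul (idem σ) (idem θ))
      exact (dom_iff _ _ _).2
        ⟨v, rel_mul_of_rel (rel_idem.2 (θ.refl u)) (rel_idem.2 huv), hrefl v⟩
    exact rel_of_dom (h (rel_idem.1 hxy)) (hrefl y)

/-- The inverse of an element of the dual symmetric inverse semigroup. -/
def inv (ξ : DualSymInv X) : DualSymInv X := ⟨ξ.cod, ξ.dom, ξ.bij.symm⟩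

theorem rel_inv {ξ : DualSymInv X} {x y : X} : ξ.inv.rel x y ↔ ξ.rel y x :=
  (Equiv.symm_apply_eq ξ.bij).trans eq_comm

theorem inv_mul (ξ : DualSymInv X) : ξ.inv * ξ = idem ξ.dom := by
  refine ext_rel fun x y => ⟨fun hxy => ?_, fun hxy => ?_⟩
  · refine rel_mul_min (rel_difunctional _) (fun u v w huv hvw => ?_) hxy
    exact rel_idem.2 ((dom_iff _ _ _).2 ⟨v, huv, rel_inv.1 hvw⟩)
  · obtain ⟨z, hz, hz'⟩ := (dom_iff _ _ _).1 (rel_idem.1 hxy)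
    exact rel_mul_of_rel hz (rel_inv.2 hz')

theorem mul_inv (ξ : DualSymInv X) : ξ * ξ.inv = idem ξ.cod := inv_mul ξ.inv

/-- Left multiplication can only coarsen the domain, and `p.inv * p` is the idempotent of `p.dom`.
-/
theorem greenL_idem_iff {p : DualSymInv X} {ρ : Setoid X} : GreenL p (idem ρ) ↔ p.dom = ρ := by
  constructor
  · rintro ⟨⟨x, hx⟩, ⟨y, hy⟩⟩
    refine le_antisymm ?_ ?_
    · have h := dom_le_dom_mul x p
      rwa [hx] at h
    · have h := dom_le_dom_mul y (idem ρ)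
      rwa [hy] at h
  · rintro rfl
    exact ⟨⟨p.inv, p.inv_mul⟩, ⟨p, mul_idem_of_le le_rfl⟩⟩

instance [Finite X] : Finite (DualSymInv X) :=
  Finite.of_injective rel fun _ _ h => ext_rel fun x y => by rw [h]

/-- A map `f'` is the pushforward of a map `f` along `ξ`. -/
def Pushes {Y : Type*} (ξ : DualSymInv X) (f f' : X → Y) : Prop :=
  ∀ x y, ξ.rel x y → f' y = f x

/-- Such an `f` is constant on the parts of `ξ.dom`, so it can be transported along the bijection of
parts. -/
theorem exists_pushes {Y : Type*} {ξ : DualSymInv X} {f : X → Y} (h : ξ.dom ≤ Setoid.ker f) :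
    ∃ f', ξ.Pushes f f' := by
  choose u hu using ξ.exists_rel_left
  exact ⟨fun y => f (u y), fun x y hxy => h ((ξ.dom_iff _ _).2 ⟨y, hu y, hxy⟩)⟩

theorem Pushes.surjective {Y : Type*} {ξ : DualSymInv X} {f f' : X → Y} (h : ξ.Pushes f f')
    (hf : Function.Surjective f) : Function.Surjective f' := by
  intro i
  obtain ⟨x, rfl⟩ := hf i
  obtain ⟨y, hy⟩ := ξ.exists_rel_right x
  exact ⟨y, h x y hy⟩

theorem pushes_idem {Y : Type*} {σ : Setoid X} {f : X → Y} (h : σ ≤ Setoid.ker f) :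
    (idem σ).Pushes f f :=
  fun _ _ hxy => (h (rel_idem.1 hxy)).symm

end DualSymInv

/-! ### Left cells as sets of surjections -/

/-- The surjections from `X` to `Fin k`. -/
abbrev Surj (X : Type*) (k : ℕ) : Type _ := {f : X → Fin k // Function.Surjective f}

namespace Surj

variable {X : Type*} {k : ℕ}

/-- Postcomposition of a surjection with a permutation. -/
def post (g : Equiv.Perm (Fin k)) (f : Surj X k) : Surj X k :=
  ⟨g ∘ f.1, g.surjective.comp f.2⟩

/-- The surjection given by an enumeration of the parts of a set partition. -/
def ofEquiv {ρ : Setoid X} (e : Quotient ρ ≃ Fin k) : Surj X k :=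
  ⟨fun x => e (Quotient.mk ρ x), e.surjective.comp Quotient.mk_surjective⟩

theorem ker_ofEquiv {ρ : Setoid X} (e : Quotient ρ ≃ Fin k) : Setoid.ker (ofEquiv e).1 = ρ :=
  Setoid.ext fun x y => by
    rw [Setoid.ker_def, ofEquiv, e.injective.eq_iff]
    exact Quotient.eq (r := ρ)

/-- Two surjections onto sets of the same size with comparable kernels differ by a permutation. -/
theorem exists_eq_post {f f' : Surj X k} (h : Setoid.ker f.1 ≤ Setoid.ker f'.1) :
    ∃ g : Equiv.Perm (Fin k), f' = post g f := by
  choose u hu using f.2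
  let g : Fin k → Fin k := fun i => f'.1 (u i)
  have hg (x : X) : g (f.1 x) = f'.1 x := h (hu (f.1 x))
  have hs : Function.Surjective g := by
    intro i
    obtain ⟨x, rfl⟩ := f'.2 i
    exact ⟨f.1 x, hg x⟩
  exact ⟨Equiv.ofBijective g (Finite.surjective_iff_bijective.1 hs),
    Subtype.ext (funext fun x => (hg x).symm)⟩

end Surj

section Cells

open DualSymInv

variable {X : Type*} {k : ℕ} {ρ : Setoid X} (e : Quotient ρ ≃ Fin k)

/-- The element of the left cell of `ρ` with the parts of the codomain given by a surjection. -/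
def cellElem (f : Surj X k) : DualSymInv X :=
  ⟨ρ, Setoid.ker f.1, e.trans (Setoid.quotientKerEquivOfSurjective f.1 f.2).symm⟩

theorem rel_cellElem {f : Surj X k} {x y : X} :
    (cellElem e f).rel x y ↔ e (Quotient.mk ρ x) = f.1 y :=
  Equiv.symm_apply_eq (Setoid.quotientKerEquivOfSurjective f.1 f.2)

theorem greenL_cellElem (f : Surj X k) : GreenL (cellElem e f) (idem ρ) :=
  greenL_idem_iff.2 rfl

/-- With the domain fixed and its parts numbered, `p` is determined by the number of the part that
is sent to the part of each point `y`. -/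
theorem exists_eq_cellElem {p : DualSymInv X} (hp : p.dom = ρ) : ∃ f, p = cellElem e f := by
  subst hp
  choose u hu using p.exists_rel_left
  have h (x y : X) : p.rel x y ↔ e (Quotient.mk p.dom x) = e (Quotient.mk p.dom (u y)) := by
    rw [e.injective.eq_iff]
    exact ⟨fun hxy => Quotient.sound ((p.dom_iff _ _).2 ⟨y, hxy, hu y⟩),
      fun hxy => rel_of_dom (Quotient.exact hxy) (hu y)⟩
  refine ⟨⟨fun y => e (Quotient.mk p.dom (u y)), fun i => ?_⟩, ext_rel fun x y => ?_⟩
  · obtain ⟨x, hx⟩ := Quotient.mk_surjective (e.symm i)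
    obtain ⟨y, hy⟩ := p.exists_rel_right x
    exact ⟨y, ((h x y).1 hy).symm.trans (by rw [hx, e.apply_symm_apply])⟩
  · rw [rel_cellElem, h]

theorem mul_cellElem {ξ : DualSymInv X} {f f' : Surj X k} (h : ξ.Pushes f.1 f'.1) :
    ξ * cellElem e f = cellElem e f' := by
  refine ext_rel fun x z => ⟨fun hxz => ?_, fun hxz => ?_⟩
  · refine rel_mul_min (rel_difunctional _) (fun u v w huv hvw => ?_) hxz
    rw [rel_cellElem] at huv ⊢
    rw [huv, h v w hvw]
  · obtain ⟨y, hy⟩ := ξ.exists_rel_left z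
    refine rel_mul_of_rel ((rel_cellElem e).2 ?_) hy
    rw [(rel_cellElem e).1 hxz, h y z hy]

/-- Complements `mul_cellElem`: a product with `ξ` stays in the left cell only if `f` can be pushed
forward along `ξ`. -/
theorem dom_le_ker_of_dom_mul_cellElem {ξ : DualSymInv X} {f : Surj X k}
    (h : (ξ * cellElem e f).dom = ρ) : ξ.dom ≤ Setoid.ker f.1 := by
  intro y y' hy
  obtain ⟨z, hz, hz'⟩ := (ξ.dom_iff y y').1 hy
  obtain ⟨x, hx⟩ := (cellElem e f).exists_rel_left y
  obtain ⟨x', hx'⟩ := (cellElem e f).exists_rel_left y'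
  have h1 : ρ x x' := h ▸ ((ξ * cellElem e f).dom_iff x x').2
    ⟨z, rel_mul_of_rel hx hz, rel_mul_of_rel hx' hz'⟩
  rw [Setoid.ker_def, ← (rel_cellElem e).1 hx, ← (rel_cellElem e).1 hx', Quotient.sound h1]

/-- The element of the maximal subgroup of `ρ` given by a permutation of the enumerated parts. -/
def groupElem : Equiv.Perm (Fin k) →ₙ* DualSymInv X where
  toFun g := ofPerm ρ (e.symm.permCongr g)
  map_mul' g h := by
    rw [← ofPerm_mul]
    congr 1
    ext x
    simp

theorem rel_groupElem {g : Equiv.Perm (Fin k)} {x y : X} :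
    (groupElem e g).rel x y ↔ g (e (Quotient.mk ρ x)) = e (Quotient.mk ρ y) :=
  Equiv.symm_apply_eq e

/-- The image of `1` is `idem ρ`, in general not the identity of the monoid; hence `groupElem` and
`groupAlg` are non-unital. -/
theorem groupElem_one : groupElem e 1 = idem ρ :=
  ext_rel fun x y => by
    rw [rel_groupElem, rel_idem, Equiv.Perm.one_apply, e.injective.eq_iff]
    exact Quotient.eq (r := ρ)

/-- Right multiplication by `g` replaces a surjection by its composite with `g⁻¹`; the inverse in
`rightRep` turns this into composition with `g`. -/
theorem cellElem_mul_groupElem (f : Surj X k) (g : Equiv.Perm (Fin k)) :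
    cellElem e (Surj.post g f) * groupElem e g = cellElem e f := by
  refine ext_rel fun x z => ⟨fun hxz => ?_, fun hxz => ?_⟩
  · refine rel_mul_min (rel_difunctional _) (fun u v w huv hvw => ?_) hxz
    rw [rel_cellElem] at hvw ⊢
    rw [rel_groupElem, hvw] at huv
    exact g.injective huv
  · obtain ⟨y, hy⟩ := (groupElem e g).exists_rel_right x
    refine rel_mul_of_rel hy ?_
    rw [rel_cellElem] at hxz ⊢
    rw [← (rel_groupElem e).1 hy, hxz]
    rfl

theorem cellElem_ofEquiv : cellElem e (Surj.ofEquiv e) = idem ρ :=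
  ext_rel fun x y => by
    rw [rel_cellElem, rel_idem]
    exact e.injective.eq_iff.trans (Quotient.eq (r := ρ))

theorem pushes_groupElem (g : Equiv.Perm (Fin k)) :
    (groupElem e g).Pushes (Surj.ofEquiv e).1 (Surj.post g⁻¹ (Surj.ofEquiv e)).1 := by
  intro x y hxy
  change g⁻¹ (e (Quotient.mk ρ y)) = e (Quotient.mk ρ x)
  rw [← (rel_groupElem e).1 hxy]
  simp

/-- The inverse of an element of the left cell maps the surjection back to the enumeration. -/
theorem pushes_inv_cellElem (f : Surj X k) :
    (cellElem e f).inv.Pushes f.1 (Surj.ofEquiv e).1 :=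
  fun _ _ hxy => (rel_cellElem e).1 (rel_inv.1 hxy)

theorem pushes_cellElem (f : Surj X k) :
    (cellElem e f).Pushes (Surj.ofEquiv e).1 f.1 :=
  fun _ _ hxy => ((rel_cellElem e).1 hxy).symm

theorem groupElem_eq_cellElem (g : Equiv.Perm (Fin k)) :
    groupElem e g = cellElem e (Surj.post g⁻¹ (Surj.ofEquiv e)) :=
  ext_rel fun x y => by
    rw [rel_groupElem, rel_cellElem]
    exact Equiv.Perm.eq_inv_iff_eq.symm

end Cells

/-! ### The modules `N` in terms of surjections -/

section NModules

open DualSymInv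

variable (𝕜 : Type*) [CommRing 𝕜] {X : Type*} {k : ℕ} {ρ : Setoid X} (e : Quotient ρ ≃ Fin k)
  (lam : YoungDiagram)

/-- The projection from the tensor product over the field to the module `N`. -/
def nMk : (LeftCell (idem ρ) →₀ 𝕜) ⊗[𝕜] SpechtSpace 𝕜 k lam →ₗ[𝕜] NSpace 𝕜 e lam :=
  Representation.Coinvariants.mk _

/-- The element `p ⊗ v` of the module `N`, where `p` is given by a surjection. -/
def nGen (f : Surj X k) : SpechtSpace 𝕜 k lam →ₗ[𝕜] NSpace 𝕜 e lam :=
  nMk 𝕜 e lam ∘ₗ TensorProduct.mk 𝕜 (LeftCell (idem ρ) →₀ 𝕜) (SpechtSpace 𝕜 k lam)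
    (Finsupp.single ⟨cellElem e f, greenL_cellElem e f⟩ 1)

variable {𝕜 lam}

theorem nGen_apply (f : Surj X k) (v : SpechtSpace 𝕜 k lam) : nGen 𝕜 e lam f v =
    nMk 𝕜 e lam (Finsupp.single ⟨cellElem e f, greenL_cellElem e f⟩ 1 ⊗ₜ[𝕜] v) := rfl

theorem nMk_map (g : Equiv.Perm (Fin k))
    (x : (LeftCell (idem ρ) →₀ 𝕜) ⊗[𝕜] SpechtSpace 𝕜 k lam) :
    nMk 𝕜 e lam (TensorProduct.map (rightRep 𝕜 e g) (specht 𝕜 k lam g) x) = nMk 𝕜 e lam x :=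
  Representation.Coinvariants.mk_self_apply
    (V := (LeftCell (idem ρ) →₀ 𝕜) ⊗[𝕜] SpechtSpace 𝕜 k lam) _ g x

theorem simpleRep_nMk (ξ : DualSymInv X) (x : LeftCell (idem ρ) →₀ 𝕜) (v : SpechtSpace 𝕜 k lam) :
    simpleRep 𝕜 e lam ξ (nMk 𝕜 e lam (x ⊗ₜ[𝕜] v)) =
      nMk 𝕜 e lam (cellRep 𝕜 (idem ρ) ξ x ⊗ₜ[𝕜] v) := rfl

theorem nSpace_hom_ext {W : Type*} [AddCommGroup W] [Module 𝕜 W] {F G : NSpace 𝕜 e lam →ₗ[𝕜] W}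
    (h : ∀ f, F ∘ₗ nGen 𝕜 e lam f = G ∘ₗ nGen 𝕜 e lam f) : F = G := by
  refine Representation.Coinvariants.hom_ext (TensorProduct.ext (Finsupp.lhom_ext' fun p => ?_))
  obtain ⟨f, hf⟩ := exists_eq_cellElem e (greenL_idem_iff.1 p.2)
  obtain rfl : p = ⟨cellElem e f, greenL_cellElem e f⟩ := Subtype.ext hf
  ext v
  exact LinearMap.congr_fun (h f) v

theorem simpleRep_nGen {ξ : DualSymInv X} {f f' : Surj X k} (h : ξ.Pushes f.1 f'.1)
    (v : SpechtSpace 𝕜 k lam) :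
    simpleRep 𝕜 e lam ξ (nGen 𝕜 e lam f v) = nGen 𝕜 e lam f' v := by
  have h1 : GreenL (ξ * cellElem e f) (idem ρ) := by
    rw [mul_cellElem e h]
    exact greenL_cellElem e f'
  have h2 : cellRep 𝕜 (idem ρ) ξ (Finsupp.single ⟨cellElem e f, greenL_cellElem e f⟩ 1) =
      Finsupp.single ⟨cellElem e f', greenL_cellElem e f'⟩ 1 := by
    change Finsupp.linearCombination 𝕜 _ _ = _
    rw [Finsupp.linearCombination_single, one_smul, cellAct, dif_pos h1]
    congr 1
    exact Subtype.ext (mul_cellElem e h)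
  rw [nGen_apply, simpleRep_nMk, h2, nGen_apply]

theorem simpleRep_nGen_eq_zero {ξ : DualSymInv X} {f : Surj X k} (h : ¬ ξ.dom ≤ Setoid.ker f.1)
    (v : SpechtSpace 𝕜 k lam) :
    simpleRep 𝕜 e lam ξ (nGen 𝕜 e lam f v) = 0 := by
  have h2 : cellRep 𝕜 (idem ρ) ξ (Finsupp.single ⟨cellElem e f, greenL_cellElem e f⟩ 1) = 0 := by
    change Finsupp.linearCombination 𝕜 _ _ = _
    rw [Finsupp.linearCombination_single, one_smul, cellAct, dif_neg]
    exact fun h1 => h (dom_le_ker_of_dom_mul_cellElem e (greenL_idem_iff.1 h1))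
  rw [nGen_apply, simpleRep_nMk, h2, TensorProduct.zero_tmul, map_zero]

theorem mulPerm_cellElem (f : Surj X k) (g : Equiv.Perm (Fin k)) :
    LeftCell.mulPerm ⟨cellElem e f, greenL_cellElem e f⟩ (e.symm.permCongr g⁻¹) =
      ⟨cellElem e (Surj.post g f), greenL_cellElem e _⟩ := by
  refine Subtype.ext ?_
  have h := cellElem_mul_groupElem e (Surj.post g f) g⁻¹
  rwa [show Surj.post g⁻¹ (Surj.post g f) = f from Subtype.ext (by ext; simp [Surj.post])] at h

theorem rightRep_single (f : Surj X k) (g : Equiv.Perm (Fin k)) :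
    rightRep 𝕜 e g (Finsupp.single ⟨cellElem e f, greenL_cellElem e f⟩ 1) =
      Finsupp.single ⟨cellElem e (Surj.post g f), greenL_cellElem e _⟩ 1 := by
  change Finsupp.mapDomain _ _ = _
  rw [Finsupp.mapDomain_single, mulPerm_cellElem]

/-- This is the relation that defines the tensor product over the group algebra, in terms of
surjections. By `exists_nSpace_lift` there are no others. -/
theorem nGen_post (f : Surj X k) (g : Equiv.Perm (Fin k)) (v : SpechtSpace 𝕜 k lam) :
    nGen 𝕜 e lam (Surj.post g f) (specht 𝕜 k lam g v) = nGen 𝕜 e lam f v := by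
  have h := nMk_map (𝕜 := 𝕜) (lam := lam) e g
    (Finsupp.single ⟨cellElem e f, greenL_cellElem e f⟩ 1 ⊗ₜ[𝕜] v)
  rw [TensorProduct.map_tmul, rightRep_single] at h
  exact h

/-- A family of linear maps that is compatible with the symmetric group gives a linear map on the
module `N`. -/
theorem exists_nSpace_lift {W : Type*} [AddCommGroup W] [Module 𝕜 W]
    (F : Surj X k → SpechtSpace 𝕜 k lam →ₗ[𝕜] W)
    (hF : ∀ f g v, F (Surj.post g f) (specht 𝕜 k lam g v) = F f v) :
    ∃ L : NSpace 𝕜 e lam →ₗ[𝕜] W, ∀ f v, L (nGen 𝕜 e lam f v) = F f v := by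
  choose s hs using fun p : LeftCell (idem ρ) => exists_eq_cellElem e (greenL_idem_iff.1 p.2)
  have hinj {f f' : Surj X k} (h : cellElem e f = cellElem e f') : f = f' := by
    refine Subtype.ext (funext fun y => ?_)
    obtain ⟨x, hx⟩ := (cellElem e f).exists_rel_left y
    rw [← (rel_cellElem e).1 hx, (rel_cellElem e).1 (h ▸ hx)]
  have hs' (f : Surj X k) : s ⟨cellElem e f, greenL_cellElem e f⟩ = f :=
    (hinj (hs ⟨cellElem e f, greenL_cellElem e f⟩)).symm
  let L₀ : (LeftCell (idem ρ) →₀ 𝕜) ⊗[𝕜] SpechtSpace 𝕜 k lam →ₗ[𝕜] W :=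
    TensorProduct.lift (Finsupp.linearCombination 𝕜 fun p => F (s p))
  have hL₀ (f : Surj X k) (v : SpechtSpace 𝕜 k lam) :
      L₀ (Finsupp.single ⟨cellElem e f, greenL_cellElem e f⟩ 1 ⊗ₜ v) = F f v := by
    simp only [L₀, TensorProduct.lift.tmul, Finsupp.linearCombination_single, one_smul, hs']
  refine ⟨Representation.Coinvariants.lift _ L₀ fun g => ?_, fun f v => hL₀ f v⟩
  refine TensorProduct.ext (Finsupp.lhom_ext' fun p => ?_)
  obtain ⟨f, hf⟩ := exists_eq_cellElem e (greenL_idem_iff.1 p.2)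
  obtain rfl : p = ⟨cellElem e f, greenL_cellElem e f⟩ := Subtype.ext hf
  ext v
  change L₀ (rightRep 𝕜 e g (Finsupp.single _ _) ⊗ₜ[𝕜] _) = L₀ (_ ⊗ₜ _)
  rw [rightRep_single]
  exact (hL₀ _ _).trans ((hF f g v).trans (hL₀ f v).symm)

end NModules

/-! ### The top vectors of a module at a set partition -/

section TopVectors

open DualSymInv

variable (𝕜 : Type*) [Field 𝕜] {X : Type*} {k : ℕ} {ρ : Setoid X} (e : Quotient ρ ≃ Fin k)

/-- The idempotent of a set partition in the monoid algebra. -/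
def idemAlg (σ : Setoid X) : MonoidAlgebra 𝕜 (DualSymInv X) := MonoidAlgebra.single (idem σ) 1

theorem idemAlg_mul_idemAlg (σ θ : Setoid X) :
    idemAlg 𝕜 σ * idemAlg 𝕜 θ = idemAlg 𝕜 (σ ⊔ θ) := by
  rw [idemAlg, idemAlg, MonoidAlgebra.single_mul_single, idem_mul_idem, one_mul, idemAlg]

theorem idemAlg_commute (σ θ : Setoid X) : Commute (idemAlg 𝕜 σ) (idemAlg 𝕜 θ) := by
  rw [Commute, SemiconjBy, idemAlg_mul_idemAlg, idemAlg_mul_idemAlg, sup_comm]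

instance [Finite X] : Finite (Setoid X) :=
  Finite.of_injective (fun r : Setoid X => fun x y => r x y)
    fun _ _ h => Setoid.ext fun x y => Iff.of_eq (congrFun (congrFun h x) y)

variable (ρ) in
/-- The list of the set partitions that are strictly coarser than a given one. -/
def coarserList [Finite X] : List (Setoid X) := (Set.toFinite {σ | ρ < σ}).toFinset.toList

theorem mem_coarserList [Finite X] {σ : Setoid X} : σ ∈ coarserList ρ ↔ ρ < σ := by
  simp [coarserList]

variable (ρ) in
/-- The primitive idempotent of a set partition in the subalgebra of the idempotents. -/
def primIdem [Finite X] : MonoidAlgebra 𝕜 (DualSymInv X) :=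
  ((coarserList ρ).map fun σ => 1 - idemAlg 𝕜 σ).prod * idemAlg 𝕜 ρ

/-- The monoid algebra need not be commutative, so the product in `primIdem` runs over a list; its
factors commute with the idempotents of set partitions. -/
theorem commute_prod_one_sub (σ : Setoid X) (l : List (Setoid X)) :
    Commute (idemAlg 𝕜 σ) (l.map fun θ => 1 - idemAlg 𝕜 θ).prod := by
  refine Commute.list_prod_right _ _ fun x hx => ?_
  obtain ⟨θ, -, rfl⟩ := List.mem_map.1 hx
  exact (Commute.one_right _).sub_right (idemAlg_commute 𝕜 σ θ)

theorem idemAlg_mul_prod_one_sub {σ : Setoid X} {l : List (Setoid X)} (h : σ ∈ l) :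
    idemAlg 𝕜 σ * (l.map fun θ => 1 - idemAlg 𝕜 θ).prod = 0 := by
  induction l with
  | nil => simp at h
  | cons θ l ih =>
    rw [List.map_cons, List.prod_cons]
    rcases List.mem_cons.1 h with rfl | h
    · rw [← mul_assoc, mul_sub, mul_one, idemAlg_mul_idemAlg, sup_idem, sub_self, zero_mul]
    · rw [← mul_assoc, ((Commute.one_right _).sub_right (idemAlg_commute 𝕜 σ θ)).eq, mul_assoc,
        ih h, mul_zero]

theorem commute_primIdem [Finite X] (σ : Setoid X) :
    Commute (idemAlg 𝕜 σ) (primIdem 𝕜 ρ) :=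
  (commute_prod_one_sub 𝕜 σ _).mul_right (idemAlg_commute 𝕜 σ ρ)

theorem idemAlg_mul_primIdem_self [Finite X] : idemAlg 𝕜 ρ * primIdem 𝕜 ρ = primIdem 𝕜 ρ := by
  rw [primIdem, ← mul_assoc, (commute_prod_one_sub 𝕜 ρ _).eq, mul_assoc, idemAlg_mul_idemAlg,
    sup_idem]

theorem idemAlg_mul_primIdem [Finite X] {σ : Setoid X} (h : ρ < σ) :
    idemAlg 𝕜 σ * primIdem 𝕜 ρ = 0 := by
  rw [primIdem, ← mul_assoc, idemAlg_mul_prod_one_sub 𝕜 (mem_coarserList.2 h), zero_mul]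

variable (ρ) (W : Type*) [AddCommGroup W] [Module 𝕜 W] [Module (MonoidAlgebra 𝕜 (DualSymInv X)) W]
  [IsScalarTower 𝕜 (MonoidAlgebra 𝕜 (DualSymInv X)) W]

/-- The vectors fixed by the idempotent of `ρ` and killed by all smaller idempotents. -/
def topVectors : Submodule 𝕜 W where
  carrier := {w | idemAlg 𝕜 ρ • w = w ∧ ∀ σ, ρ < σ → idemAlg 𝕜 σ • w = 0}
  add_mem' {a b} ha hb :=
    ⟨by rw [smul_add, ha.1, hb.1], fun σ h => by rw [smul_add, ha.2 σ h, hb.2 σ h, add_zero]⟩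
  zero_mem' := ⟨smul_zero _, fun _ _ => smul_zero _⟩
  smul_mem' c w hw := by
    have : SMulCommClass 𝕜 (MonoidAlgebra 𝕜 (DualSymInv X)) W := IsScalarTower.to_smulCommClass
    exact ⟨by rw [← smul_comm, hw.1], fun σ h => by rw [← smul_comm, hw.2 σ h, smul_zero]⟩

variable {ρ} {W}

theorem primIdem_smul_mem [Finite X] (w : W) : primIdem 𝕜 ρ • w ∈ topVectors 𝕜 ρ W :=
  ⟨by rw [smul_smul, idemAlg_mul_primIdem_self],
    fun σ h => by rw [smul_smul, idemAlg_mul_primIdem 𝕜 h, zero_smul]⟩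

/-- Each factor `1 - e_θ` fixes a vector killed by `e_θ`. Together with `primIdem_smul_mem` this
makes `primIdem` the projection onto the top vectors. -/
theorem primIdem_smul_of_mem [Finite X] {w : W} (hw : w ∈ topVectors 𝕜 ρ W) :
    primIdem 𝕜 ρ • w = w := by
  have h (l : List (Setoid X)) (hl : ∀ σ ∈ l, ρ < σ) :
      (l.map fun θ => 1 - idemAlg 𝕜 θ).prod • w = w := by
    induction l with
    | nil => simp
    | cons θ l ih =>
      rw [List.map_cons, List.prod_cons, mul_smul, ih fun σ hσ => hl σ (List.mem_cons_of_mem _ hσ),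
        sub_smul, one_smul, hw.2 θ (hl θ List.mem_cons_self), sub_zero]
  rw [primIdem, mul_smul, hw.1, h _ fun σ => mem_coarserList.1]

/-- The algebra of the symmetric group inside the algebra of the dual symmetric inverse
semigroup, as the linearization of a maximal subgroup. -/
def groupAlg : MonoidAlgebra 𝕜 (Equiv.Perm (Fin k)) →ₙₐ[𝕜] MonoidAlgebra 𝕜 (DualSymInv X) :=
  MonoidAlgebra.mapDomainNonUnitalAlgHom 𝕜 𝕜 (groupElem e)

theorem groupAlg_single (g : Equiv.Perm (Fin k)) (c : 𝕜) :
    groupAlg 𝕜 e (MonoidAlgebra.single g c) = MonoidAlgebra.single (groupElem e g) c :=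
  MonoidAlgebra.mapDomain_single

/-- The product leaves the left cell, so its domain is strictly coarser than `ρ`. It absorbs the
idempotent of its domain on the right, and that idempotent kills `w`. -/
theorem single_mul_cellElem_smul_eq_zero {w : W} (hw : w ∈ topVectors 𝕜 ρ W) {ξ : DualSymInv X}
    {f : Surj X k} (h : ¬ ξ.dom ≤ Setoid.ker f.1) :
    MonoidAlgebra.single (ξ * cellElem e f) (1 : 𝕜) • w = 0 := by
  have h1 : ρ ≤ (ξ * cellElem e f).dom := dom_le_dom_mul ξ (cellElem e f)
  have h2 : ρ ≠ (ξ * cellElem e f).dom := fun h2 =>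
    h (dom_le_ker_of_dom_mul_cellElem e h2.symm)
  have h3 := mul_idem_of_le (le_refl (ξ * cellElem e f).dom)
  rw [← h3, ← mul_one (1 : 𝕜), ← MonoidAlgebra.single_mul_single, mul_smul]
  exact (congrArg _ (hw.2 _ (lt_of_le_of_ne h1 h2))).trans (smul_zero _)

theorem groupElem_smul_mem {w : W} (hw : w ∈ topVectors 𝕜 ρ W) (g : Equiv.Perm (Fin k)) :
    MonoidAlgebra.single (groupElem e g) (1 : 𝕜) • w ∈ topVectors 𝕜 ρ W := by
  refine ⟨?_, fun σ hσ => ?_⟩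
  · rw [idemAlg, ← groupElem_one e, smul_smul, MonoidAlgebra.single_mul_single, ← map_mul, one_mul,
      one_mul]
  · rw [idemAlg, smul_smul, MonoidAlgebra.single_mul_single, groupElem_eq_cellElem, one_mul]
    refine single_mul_cellElem_smul_eq_zero 𝕜 e hw fun h => ?_
    have h1 : Setoid.ker (Surj.post g⁻¹ (Surj.ofEquiv e)).1 = ρ := by
      refine Eq.trans ?_ (Surj.ker_ofEquiv e)
      ext x y
      simp [Surj.post, Setoid.ker_def]
    exact hσ.not_ge (h.trans_eq h1)

theorem groupAlg_smul_mem {w : W} (hw : w ∈ topVectors 𝕜 ρ W)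
    (r : MonoidAlgebra 𝕜 (Equiv.Perm (Fin k))) : groupAlg 𝕜 e r • w ∈ topVectors 𝕜 ρ W := by
  induction r using MonoidAlgebra.induction_linear with
  | zero => rw [map_zero, zero_smul]; exact zero_mem _
  | add r s hr hs => rw [map_add, add_smul]; exact add_mem hr hs
  | single g c =>
    rw [groupAlg_single, ← mul_one c, ← smul_eq_mul, ← MonoidAlgebra.smul_single, smul_assoc]
    exact Submodule.smul_mem _ _ (groupElem_smul_mem 𝕜 e hw g)

/-- The idempotent of the monoid algebra given by an idempotent of the algebra of the
symmetric group. -/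
def liftIdem [Finite X] (ε : MonoidAlgebra 𝕜 (Equiv.Perm (Fin k))) :
    MonoidAlgebra 𝕜 (DualSymInv X) :=
  groupAlg 𝕜 e ε * primIdem 𝕜 ρ

/-- First `primIdem` projects onto the top vectors, and then `ε` acts inside them, because the
maximal subgroup preserves them. -/
theorem mem_fixedVectors_liftIdem [Finite X] {ε : MonoidAlgebra 𝕜 (Equiv.Perm (Fin k))}
    (hε : IsIdempotentElem ε) {w : W} : w ∈ fixedVectors 𝕜 (liftIdem 𝕜 e ε) W ↔
      w ∈ topVectors 𝕜 ρ W ∧ groupAlg 𝕜 e ε • w = w := by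
  rw [mem_fixedVectors, liftIdem, mul_smul]
  refine ⟨fun h => ⟨?_, ?_⟩, fun h => ?_⟩
  · rw [← h]
    exact groupAlg_smul_mem 𝕜 e (primIdem_smul_mem 𝕜 w) ε
  · conv_lhs => rw [← h]
    rw [smul_smul, ← map_mul, hε, h]
  · rw [primIdem_smul_of_mem 𝕜 h.1, h.2]

theorem isIdempotentElem_liftIdem [Finite X] {ε : MonoidAlgebra 𝕜 (Equiv.Perm (Fin k))}
    (hε : IsIdempotentElem ε) : IsIdempotentElem (liftIdem 𝕜 e ε) := by
  -- Idempotency says that the element is a fixed vector of itself in the regular module.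
  refine (mem_fixedVectors_liftIdem 𝕜 e hε).2 ⟨?_, ?_⟩
  · have h := primIdem_smul_mem 𝕜 (ρ := ρ) (1 : MonoidAlgebra 𝕜 (DualSymInv X))
    rw [smul_eq_mul, mul_one] at h
    exact groupAlg_smul_mem 𝕜 e h ε
  · rw [smul_eq_mul, liftIdem, ← mul_assoc, ← map_mul, hε]

variable {M : Type*} [AddCommGroup M] [Module 𝕜 M] [Module (MonoidAlgebra 𝕜 (Equiv.Perm (Fin k))) M]
  [IsScalarTower 𝕜 (MonoidAlgebra 𝕜 (Equiv.Perm (Fin k))) M]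

theorem map_smul_eq_groupAlg_smul {θ : M →ₗ[𝕜] W}
    (h : ∀ (g : Equiv.Perm (Fin k)) v, θ (MonoidAlgebra.single g (1 : 𝕜) • v) =
      MonoidAlgebra.single (groupElem e g) (1 : 𝕜) • θ v)
    (r : MonoidAlgebra 𝕜 (Equiv.Perm (Fin k))) (v : M) :
    θ (r • v) = groupAlg 𝕜 e r • θ v := by
  induction r using MonoidAlgebra.induction_linear with
  | zero => rw [map_zero, zero_smul, zero_smul, map_zero]
  | add r s hr hs => rw [map_add, add_smul, add_smul, map_add, hr, hs]
  | single g c =>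
    rw [groupAlg_single, ← mul_one c, ← smul_eq_mul, ← MonoidAlgebra.smul_single,
      ← MonoidAlgebra.smul_single, smul_assoc, smul_assoc, map_smul, h]

/-- If a module over the symmetric group is identified with the top vectors of a module over the
dual symmetric inverse semigroup, then the fixed vectors of corresponding idempotents agree. -/
theorem finrank_fixedVectors_liftIdem [Finite X] {θ : M →ₗ[𝕜] W}
    (h : ∀ (g : Equiv.Perm (Fin k)) v, θ (MonoidAlgebra.single g (1 : 𝕜) • v) =
      MonoidAlgebra.single (groupElem e g) (1 : 𝕜) • θ v)
    (hinj : Function.Injective θ) (hrange : LinearMap.range θ = topVectors 𝕜 ρ W)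
    {ε : MonoidAlgebra 𝕜 (Equiv.Perm (Fin k))} (hε : IsIdempotentElem ε) :
    Module.finrank 𝕜 (fixedVectors 𝕜 (liftIdem 𝕜 e ε) W) =
      Module.finrank 𝕜 (fixedVectors 𝕜 ε M) := by
  have h1 (v : M) : θ v ∈ fixedVectors 𝕜 (liftIdem 𝕜 e ε) W ↔ v ∈ fixedVectors 𝕜 ε M := by
    rw [mem_fixedVectors_liftIdem 𝕜 e hε, ← map_smul_eq_groupAlg_smul 𝕜 e h, hinj.eq_iff,
      mem_fixedVectors]
    exact and_iff_right (hrange ▸ LinearMap.mem_range_self θ v)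
  have h2 : fixedVectors 𝕜 (liftIdem 𝕜 e ε) W = (fixedVectors 𝕜 ε M).map θ := by
    ext w
    constructor
    · intro hw
      obtain ⟨v, rfl⟩ : w ∈ LinearMap.range θ :=
        hrange ▸ ((mem_fixedVectors_liftIdem 𝕜 e hε).1 hw).1
      exact ⟨v, (h1 v).1 hw, rfl⟩
    · rintro ⟨v, hv, rfl⟩
      exact (h1 v).2 hv
  rw [h2]
  exact ((fixedVectors 𝕜 ε M).equivMapOfInjective θ hinj).finrank_eq.symm

end TopVectors

/-! ### Simplicity of the modules `N` -/

section NSimple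

open DualSymInv

variable {𝕜 : Type*} [Field 𝕜] {X : Type*} {k : ℕ} {ρ : Setoid X} (e : Quotient ρ ≃ Fin k)
  {lam : YoungDiagram}

theorem nSpace_submodule_eq_top {P : Submodule 𝕜 (NSpace 𝕜 e lam)}
    (h : ∀ f v, nGen 𝕜 e lam f v ∈ P) : P = ⊤ := by
  have h1 : P.mkQ = 0 := nSpace_hom_ext e fun f => LinearMap.ext fun v =>
    (Submodule.Quotient.mk_eq_zero P).2 (h f v)
  rw [← P.ker_mkQ, h1, LinearMap.ker_zero]

theorem single_smul_asModule {G V : Type*} [Monoid G] [AddCommGroup V] [Module 𝕜 V]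
    (V' : Representation 𝕜 G V) (g : G) (v : V'.asModule) :
    MonoidAlgebra.single g (1 : 𝕜) • v = V' g v := by
  rw [Representation.single_smul, one_smul]
  rfl

theorem simpleRep_idem_nGen {σ : Setoid X} {f : Surj X k} (h : σ ≤ Setoid.ker f.1)
    (v : SpechtSpace 𝕜 k lam) :
    simpleRep 𝕜 e lam (idem σ) (nGen 𝕜 e lam f v) = nGen 𝕜 e lam f v :=
  simpleRep_nGen e (pushes_idem h) v

theorem simpleRep_idem_nGen_eq_zero {σ : Setoid X} {f : Surj X k} (h : ¬ σ ≤ Setoid.ker f.1)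
    (v : SpechtSpace 𝕜 k lam) :
    simpleRep 𝕜 e lam (idem σ) (nGen 𝕜 e lam f v) = 0 :=
  simpleRep_nGen_eq_zero e h v

/-- The inverse of an element of the left cell maps `N` to the copy of the Specht module at the
idempotent. -/
theorem exists_simpleRep_inv_eq (f : Surj X k) (v : NSpace 𝕜 e lam) :
    ∃ s, simpleRep 𝕜 e lam (cellElem e f).inv v = nGen 𝕜 e lam (Surj.ofEquiv e) s := by
  have h : (LinearMap.range (nGen 𝕜 e lam (Surj.ofEquiv e))).comap
      (simpleRep 𝕜 e lam (cellElem e f).inv) = ⊤ := by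
    refine nSpace_submodule_eq_top e fun f' s => ?_
    rw [Submodule.mem_comap]
    -- The inverse has domain `ker f`, so it kills `f'` unless `f'` is a permutation of `f`; in that
    -- case `f'` goes to a permutation of the enumeration, which `nGen_post` moves into the Specht
    -- factor.
    by_cases hf : Setoid.ker f.1 ≤ Setoid.ker f'.1
    · obtain ⟨g, rfl⟩ := Surj.exists_eq_post hf
      refine ⟨specht 𝕜 k lam g⁻¹ s, ?_⟩
      have hp : (cellElem e f).inv.Pushes (Surj.post g f).1 (Surj.post g (Surj.ofEquiv e)).1 :=
        fun x y h => congrArg g (pushes_inv_cellElem e f x y h)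
      rw [simpleRep_nGen e hp, ← nGen_post e _ g, Representation.self_inv_apply]
    · rw [simpleRep_nGen_eq_zero e hf]
      exact zero_mem _
  obtain ⟨s, hs⟩ := (h ▸ Submodule.mem_top : v ∈ (LinearMap.range (nGen 𝕜 e lam
    (Surj.ofEquiv e))).comap (simpleRep 𝕜 e lam (cellElem e f).inv))
  exact ⟨s, hs.symm⟩

/-- Among the partitions with `k` parts only `ker f` lies below `ker f`, so exactly one idempotent
of the sum fixes the generator at `f`, and the others kill it. -/
theorem sum_simpleRep_idem [Finite X] (v : NSpace 𝕜 e lam) :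
    ∑ σ ∈ (Set.toFinite (Set.range fun f : Surj X k => Setoid.ker f.1)).toFinset,
      simpleRep 𝕜 e lam (idem σ) v = v := by
  have h : ∑ σ ∈ (Set.toFinite (Set.range fun f : Surj X k => Setoid.ker f.1)).toFinset,
      simpleRep 𝕜 e lam (idem σ) = LinearMap.id := by
    refine nSpace_hom_ext e fun f => LinearMap.ext fun s => ?_
    simp only [LinearMap.comp_apply, LinearMap.sum_apply, LinearMap.id_apply]
    rw [Finset.sum_eq_single (Setoid.ker f.1)]
    · exact simpleRep_idem_nGen e le_rfl s
    · intro σ hσ hne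
      rw [Set.Finite.mem_toFinset] at hσ
      obtain ⟨f', rfl⟩ := hσ
      refine simpleRep_idem_nGen_eq_zero e (fun hle => hne ?_) s
      obtain ⟨g, rfl⟩ := Surj.exists_eq_post hle
      ext x y
      simp [Surj.post, Setoid.ker_def]
    · intro hn
      exact absurd ((Set.Finite.mem_toFinset _).2 (Set.mem_range_self f)) hn
  rw [← LinearMap.sum_apply, h, LinearMap.id_apply]

/-- The symmetric group acts freely on the surjections. So there is a retraction that sends the
generator at `f'` with vector `v` to `g v` if `f = g ∘ f'`, and to `0` if no such `g` exists. -/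
theorem nGen_injective (f : Surj X k) : Function.Injective (nGen 𝕜 e lam f) := by
  classical
  have huniq {f' : Surj X k} {g g' : Equiv.Perm (Fin k)}
      (h : Surj.post g f' = Surj.post g' f') : g = g' := by
    ext i
    obtain ⟨x, rfl⟩ := f'.2 i
    exact congrArg Fin.val (congrFun (congrArg Subtype.val h) x)
  let F (f' : Surj X k) : SpechtSpace 𝕜 k lam →ₗ[𝕜] SpechtSpace 𝕜 k lam :=
    if h : ∃ g, f = Surj.post g f' then specht 𝕜 k lam h.choose else 0
  have hF {f' : Surj X k} {g : Equiv.Perm (Fin k)} (h : f = Surj.post g f') :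
      F f' = specht 𝕜 k lam g := by
    have hex : ∃ g, f = Surj.post g f' := ⟨g, h⟩
    simp only [F, dif_pos hex]
    rw [huniq (hex.choose_spec.symm.trans h)]
  obtain ⟨L, hL⟩ := exists_nSpace_lift (𝕜 := 𝕜) e (lam := lam) F fun f' g v => by
    by_cases h : ∃ g', f = Surj.post g' (Surj.post g f')
    · obtain ⟨g', hg'⟩ := h
      rw [hF hg', hF (g := g' * g) hg', map_mul]
      rfl
    · have h2 : ¬ ∃ g', f = Surj.post g' f' := fun ⟨g', hg'⟩ => h ⟨g' * g⁻¹, by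
        rw [hg']
        exact Subtype.ext (by ext; simp [Surj.post])⟩
      simp only [F, dif_neg h, dif_neg h2, LinearMap.zero_apply]
  refine Function.LeftInverse.injective (g := L) fun v => ?_
  rw [hL, hF (g := 1) rfl, map_one]
  rfl

theorem nGen_ofEquiv_specht (g : Equiv.Perm (Fin k)) (v : SpechtSpace 𝕜 k lam) :
    nGen 𝕜 e lam (Surj.ofEquiv e) (specht 𝕜 k lam g v) =
      simpleRep 𝕜 e lam (groupElem e g) (nGen 𝕜 e lam (Surj.ofEquiv e) v) := by
  rw [simpleRep_nGen e (pushes_groupElem e g), ← nGen_post e (Surj.post g⁻¹ _) g]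
  congr 1
  exact congrArg _ (Subtype.ext (by ext; simp [Surj.post]))

variable (𝕜 lam) in
/-- The copy of the Specht module in `N` at the idempotent. -/
def nBase : (specht 𝕜 k lam).asModule →ₗ[𝕜] (simpleRep 𝕜 e lam).asModule :=
  nGen 𝕜 e lam (Surj.ofEquiv e)

theorem nBase_single_smul (g : Equiv.Perm (Fin k)) (v : (specht 𝕜 k lam).asModule) :
    nBase 𝕜 e lam (MonoidAlgebra.single g (1 : 𝕜) • v) =
      MonoidAlgebra.single (groupElem e g) (1 : 𝕜) • nBase 𝕜 e lam v := by
  rw [single_smul_asModule, single_smul_asModule]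
  exact nGen_ofEquiv_specht e g v

/-- The kernel of the enumeration is `ρ`, so every strictly coarser idempotent kills the copy.
Conversely, `idem ρ` maps all of `N` into the copy. -/
theorem range_nBase :
    LinearMap.range (nBase 𝕜 e lam) = topVectors 𝕜 ρ (simpleRep 𝕜 e lam).asModule := by
  ext w
  constructor
  · rintro ⟨v, rfl⟩
    refine ⟨?_, fun σ hσ => ?_⟩
    · rw [idemAlg, single_smul_asModule]
      exact simpleRep_idem_nGen e (Surj.ker_ofEquiv e).ge v
    · rw [idemAlg, single_smul_asModule]
      refine simpleRep_idem_nGen_eq_zero e ?_ v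
      rw [Surj.ker_ofEquiv]
      exact hσ.not_ge
  · rintro ⟨h, -⟩
    obtain ⟨s, hs⟩ := exists_simpleRep_inv_eq e (Surj.ofEquiv e) w
    have h1 : (cellElem e (Surj.ofEquiv e)).inv = idem ρ := by
      rw [cellElem_ofEquiv]
      rfl
    rw [h1] at hs
    refine ⟨s, ?_⟩
    rw [← h, idemAlg, single_smul_asModule]
    exact hs.symm

theorem nGen_eq_simpleRep_nBase (f : Surj X k) (v : SpechtSpace 𝕜 k lam) :
    nGen 𝕜 e lam f v = simpleRep 𝕜 e lam (cellElem e f) (nGen 𝕜 e lam (Surj.ofEquiv e) v) :=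
  (simpleRep_nGen e (pushes_cellElem e f) v).symm

/-- A nonzero submodule meets the copy of the Specht module: some `e_{ker f}` does not kill a vector
`u`, and then the inverse of the cell element of `f` moves `u` to a nonzero vector of the copy. By
simplicity the submodule contains the whole copy, which generates `N`. -/
theorem simpleRep_isSimpleModule [Finite X]
    [IsSimpleModule (MonoidAlgebra 𝕜 (Equiv.Perm (Fin k))) (specht 𝕜 k lam).asModule] :
    IsSimpleModule (MonoidAlgebra 𝕜 (DualSymInv X)) (simpleRep 𝕜 e lam).asModule := by
  have hS := IsSimpleModule.nontrivial (MonoidAlgebra 𝕜 (Equiv.Perm (Fin k)))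
    (specht 𝕜 k lam).asModule
  have hinj : Function.Injective (nBase 𝕜 e lam) := nGen_injective e _
  have : Nontrivial (simpleRep 𝕜 e lam).asModule := hinj.nontrivial
  rw [isSimpleModule_iff]
  refine { eq_bot_or_eq_top := fun U => or_iff_not_imp_left.2 fun hU => ?_ }
  obtain ⟨u, huU, hu⟩ := Submodule.exists_mem_ne_zero_of_ne_bot hU
  obtain ⟨f, hf⟩ : ∃ f : Surj X k, simpleRep 𝕜 e lam (idem (Setoid.ker f.1)) u ≠ 0 := by
    by_contra! h
    refine hu ((sum_simpleRep_idem e u).symm.trans (Finset.sum_eq_zero fun σ hσ => ?_))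
    rw [Set.Finite.mem_toFinset] at hσ
    obtain ⟨f, rfl⟩ := hσ
    exact h f
  obtain ⟨s, hs⟩ := exists_simpleRep_inv_eq e f u
  have hs0 : s ≠ 0 := by
    rintro rfl
    refine hf ?_
    have h1 : idem (Setoid.ker f.1) = cellElem e f * (cellElem e f).inv :=
      (DualSymInv.mul_inv (cellElem e f)).symm
    have h2 : simpleRep 𝕜 e lam (idem (Setoid.ker f.1)) u =
        simpleRep 𝕜 e lam (cellElem e f) (simpleRep 𝕜 e lam (cellElem e f).inv u) := by
      rw [h1, map_mul]
      rfl
    exact h2.trans ((congrArg _ (hs.trans (map_zero _))).trans (map_zero _))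
  let T : Submodule (MonoidAlgebra 𝕜 (Equiv.Perm (Fin k))) (specht 𝕜 k lam).asModule :=
    { (U.restrictScalars 𝕜).comap (nBase 𝕜 e lam) with
      smul_mem' := fun r v hv => by
        change nBase 𝕜 e lam (r • v) ∈ U
        rw [map_smul_eq_groupAlg_smul 𝕜 e (nBase_single_smul e)]
        exact U.smul_mem _ hv }
  have hT : T = ⊤ := by
    refine (eq_bot_or_eq_top T).resolve_left fun h => hs0 ?_
    have h1 : (show (specht 𝕜 k lam).asModule from s) ∈ T := by
      change nBase 𝕜 e lam s ∈ U
      have h2 := U.smul_mem (MonoidAlgebra.single (cellElem e f).inv 1) huU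
      rw [single_smul_asModule] at h2
      exact hs ▸ h2
    rw [h] at h1
    exact h1
  let U' : Submodule 𝕜 (simpleRep 𝕜 e lam).asModule := U.restrictScalars 𝕜
  have h : U' = ⊤ := nSpace_submodule_eq_top e fun f v => by
    rw [nGen_eq_simpleRep_nBase]
    have h1 : nBase 𝕜 e lam v ∈ U := by
      have h2 : (show (specht 𝕜 k lam).asModule from v) ∈ T := hT ▸ Submodule.mem_top
      exact h2
    have h2 := U.smul_mem (MonoidAlgebra.single (cellElem e f) 1) h1
    rw [single_smul_asModule] at h2
    exact h2
  rw [eq_top_iff]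
  intro x _
  exact (h ▸ Submodule.mem_top : x ∈ U')

/-- A simple module in which the idempotent of a simple module of the symmetric group does not
vanish is isomorphic to the module `N`. -/
theorem nonempty_linearEquiv_simpleRep [Finite X]
    [IsSimpleModule (MonoidAlgebra 𝕜 (Equiv.Perm (Fin k))) (specht 𝕜 k lam).asModule]
    {ε : MonoidAlgebra 𝕜 (Equiv.Perm (Fin k))} (hε : IsIdempotentElem ε)
    (θ : (specht 𝕜 k lam).asModule ≃ₗ[MonoidAlgebra 𝕜 (Equiv.Perm (Fin k))] Ideal.span {ε})
    {W : Type*} [AddCommGroup W] [Module 𝕜 W] [Module (MonoidAlgebra 𝕜 (DualSymInv X)) W]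
    [IsScalarTower 𝕜 (MonoidAlgebra 𝕜 (DualSymInv X)) W]
    [IsSimpleModule (MonoidAlgebra 𝕜 (DualSymInv X)) W]
    (hW : fixedVectors 𝕜 (liftIdem 𝕜 e ε) W ≠ ⊥) :
    Nonempty (W ≃ₗ[MonoidAlgebra 𝕜 (DualSymInv X)] (simpleRep 𝕜 e lam).asModule) := by
  have : SMulCommClass 𝕜 (MonoidAlgebra 𝕜 (DualSymInv X)) W := IsScalarTower.to_smulCommClass
  have := simpleRep_isSimpleModule (𝕜 := 𝕜) (lam := lam) e
  obtain ⟨w, hw, hw0⟩ := Submodule.exists_mem_ne_zero_of_ne_bot hW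
  rw [mem_fixedVectors_liftIdem 𝕜 e hε] at hw
  -- The Specht module is the left ideal of `ε`, so acting on the fixed vector `w` embeds it
  -- equivariantly in the top vectors of `W`; sending `f ⊗ v` to the cell element of `f` applied to
  -- `φ v` extends this to `N`.
  let φ : SpechtSpace 𝕜 k lam →ₗ[𝕜] W :=
    { toFun := fun s => groupAlg 𝕜 e (θ s).1 • w
      map_add' := fun s t => by
        rw [← add_smul, ← map_add]
        exact congrArg (fun x : Ideal.span {ε} => groupAlg 𝕜 e x.1 • w) (map_add θ s t)
      map_smul' := fun c s => by
        rw [RingHom.id_apply, ← smul_assoc, ← map_smul]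
        exact congrArg (fun x : Ideal.span {ε} => groupAlg 𝕜 e x.1 • w)
          (map_smul (θ.restrictScalars 𝕜) c s) }
  have hφ (g : Equiv.Perm (Fin k)) (s : SpechtSpace 𝕜 k lam) :
      φ (specht 𝕜 k lam g s) = MonoidAlgebra.single (groupElem e g) (1 : 𝕜) • φ s := by
    have h1 : (show (specht 𝕜 k lam).asModule from specht 𝕜 k lam g s) =
        MonoidAlgebra.single g (1 : 𝕜) • (show (specht 𝕜 k lam).asModule from s) :=
      (single_smul_asModule _ _ _).symm
    change groupAlg 𝕜 e (θ _).1 • w = _ • groupAlg 𝕜 e (θ _).1 • w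
    rw [smul_smul, ← groupAlg_single, ← map_mul]
    exact congrArg (fun x : Ideal.span {ε} => groupAlg 𝕜 e x.1 • w)
      ((congrArg θ h1).trans (map_smul θ _ _))
  have hφ_mem (s : SpechtSpace 𝕜 k lam) : φ s ∈ topVectors 𝕜 ρ W :=
    groupAlg_smul_mem 𝕜 e hw.1 _
  have hφ_ne : ∃ s, φ s ≠ 0 := by
    refine ⟨θ.symm ⟨ε, Ideal.mem_span_singleton_self ε⟩, ?_⟩
    change groupAlg 𝕜 e (θ (θ.symm _)).1 • w ≠ 0
    rw [θ.apply_symm_apply, hw.2]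
    exact hw0
  let act (ξ : DualSymInv X) : W →ₗ[𝕜] W :=
    Algebra.lsmul 𝕜 𝕜 W (MonoidAlgebra.single ξ (1 : 𝕜))
  have hact (ξ : DualSymInv X) (x : W) : act ξ x = MonoidAlgebra.single ξ (1 : 𝕜) • x := rfl
  have hact_mul (ξ ζ : DualSymInv X) (x : W) : act ξ (act ζ x) = act (ξ * ζ) x := by
    rw [hact, hact, hact, smul_smul, MonoidAlgebra.single_mul_single, one_mul]
  obtain ⟨L, hL⟩ := exists_nSpace_lift e (fun f : Surj X k => act (cellElem e f) ∘ₗ φ)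
    fun f g v => by
      rw [LinearMap.comp_apply, LinearMap.comp_apply, hφ, ← hact, hact_mul, cellElem_mul_groupElem]
  have hcomm (ξ : DualSymInv X) : L ∘ₗ simpleRep 𝕜 e lam ξ = act ξ ∘ₗ L := by
    refine nSpace_hom_ext e fun f => LinearMap.ext fun v => ?_
    simp only [LinearMap.comp_apply, hL, hact_mul]
    by_cases h : ξ.dom ≤ Setoid.ker f.1
    · obtain ⟨f₁, hf₁⟩ := exists_pushes h
      let f' : Surj X k := ⟨f₁, hf₁.surjective f.2⟩
      have hf' : ξ.Pushes f.1 f'.1 := hf₁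
      rw [simpleRep_nGen e hf', hL, mul_cellElem e hf']
      rfl
    -- If `ξ` takes the cell element out of its left cell, the result is zero in `N` by definition,
    -- and in `W` because `φ v` is a top vector.
    · rw [simpleRep_nGen_eq_zero e h, map_zero, hact,
        single_mul_cellElem_smul_eq_zero 𝕜 e (hφ_mem v) h]
  let L₁ : (simpleRep 𝕜 e lam).asModule →ₗ[𝕜] W := L
  let L' : (simpleRep 𝕜 e lam).asModule →ₗ[MonoidAlgebra 𝕜 (DualSymInv X)] W :=
    MonoidAlgebra.equivariantOfLinearOfComm L₁ fun ξ v => by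
      rw [single_smul_asModule]
      exact LinearMap.congr_fun (hcomm ξ) v
  have hL' : L' ≠ 0 := by
    intro h0
    obtain ⟨s, hs⟩ := hφ_ne
    refine hs ?_
    have h1 : L (nGen 𝕜 e lam (Surj.ofEquiv e) s) = 0 := LinearMap.congr_fun h0 _
    rw [hL, LinearMap.comp_apply, hact, cellElem_ofEquiv] at h1
    exact (hφ_mem s).1.symm.trans h1
  exact ⟨(LinearEquiv.ofBijective L' (LinearMap.bijective_of_ne_zero hL')).symm⟩

end NSimple

/-! ### Pairs of surjections and matrices -/

namespace QMat

variable {k l m : ℕ}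

theorem stab_smul_apply {M : QMat k l m} (ψ : Fin m ≃ M.Ones) (h : M.Stab) (p : Fin m) :
    (ψ (M.stabHom ψ h p)).1 = (h.1.1 (ψ p).1.1, h.1.2 (ψ p).1.2) := by
  change (ψ (ψ.symm (M.stabOnes h (ψ p)))).1 = _
  rw [ψ.apply_symm_apply]
  rfl

theorem mat_eq_one_iff {M : QMat k l m} (ψ : Fin m ≃ M.Ones) (x : Equiv.Perm (Fin m))
    (i : Fin k) (j : Fin l) : M.mat i j = 1 ↔ ∃ p, (ψ (x p)).1 = (i, j) := by
  constructor
  · intro h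
    exact ⟨x⁻¹ (ψ.symm ⟨(i, j), h⟩), by simp⟩
  · rintro ⟨p, hp⟩
    have h := (ψ (x p)).2
    rwa [hp] at h

theorem ext_ones {M N : QMat k l m} (h : ∀ i j, M.mat i j = 1 ↔ N.mat i j = 1) : M = N := by
  refine QMat.ext (funext fun i => funext fun j => ?_)
  have h1 := h i j
  generalize M.mat i j = a at *
  generalize N.mat i j = b at *
  revert h1
  revert a b
  decide

end QMat

section Pairs

variable {X : Type*} {k l m : ℕ} {τ : Setoid X} (eτ : Quotient τ ≃ Fin m)

/-- The pair of surjections `f`, `g` becomes the standard pair given by the matrix `M` and its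
enumeration `ψ` of the `1`-entries, after permutations `a`, `b`, `x`. -/
def Fits {M : QMat k l m} (ψ : Fin m ≃ M.Ones) (a : Equiv.Perm (Fin k)) (b : Equiv.Perm (Fin l))
    (x : Equiv.Perm (Fin m)) (f : Surj X k) (g : Surj X l) : Prop :=
  ∀ y, (ψ (x ((Surj.ofEquiv eτ).1 y))).1 = (a (f.1 y), b (g.1 y))

variable {eτ}

theorem Fits.ker_inf_ker {M : QMat k l m} {ψ : Fin m ≃ M.Ones} {a : Equiv.Perm (Fin k)}
    {b : Equiv.Perm (Fin l)} {x : Equiv.Perm (Fin m)} {f : Surj X k} {g : Surj X l}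
    (h : Fits eτ ψ a b x f g) : Setoid.ker f.1 ⊓ Setoid.ker g.1 = τ := by
  rw [← Surj.ker_ofEquiv eτ]
  ext y y'
  have hinf : (Setoid.ker f.1 ⊓ Setoid.ker g.1) y y' ↔ f.1 y = f.1 y' ∧ g.1 y = g.1 y' := Iff.rfl
  rw [hinf, Setoid.ker_def, ← x.injective.eq_iff, ← ψ.injective.eq_iff, Subtype.ext_iff, h y,
    h y', Prod.mk.injEq, a.injective.eq_iff, b.injective.eq_iff]

/-- Two fittings of the same pair differ by a row and a column permutation that carry the
`1`-entries of `M` to those of `M'`. As `C` meets every orbit once, `M' = M`, and the difference is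
an element of the stabilizer. -/
theorem Fits.stab {C : Finset (QMat k l m)}
    (hC : ∀ M : QMat k l m, ∃! N : QMat k l m, N ∈ C ∧
      N ∈ MulAction.orbit (Equiv.Perm (Fin k) × Equiv.Perm (Fin l)) M)
    {ψ : ∀ M : QMat k l m, Fin m ≃ M.Ones} {M M' : QMat k l m} (hM : M ∈ C) (hM' : M' ∈ C)
    {a a' a₀ : Equiv.Perm (Fin k)} {b b' b₀ : Equiv.Perm (Fin l)} {x x' : Equiv.Perm (Fin m)}
    {f : Surj X k} {g : Surj X l} (h : Fits eτ (ψ M) a b x f g)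
    (h' : Fits eτ (ψ M') a' b' x' (Surj.post a₀ f) (Surj.post b₀ g)) :
    M' = M ∧ ∃ s : M.Stab, s.1.1 = a' * a₀ * a⁻¹ ∧ s.1.2 = b' * b₀ * b⁻¹ ∧
      x' = M.stabHom (ψ M) s * x := by
  have key (p : Fin m) : (ψ M' (x' p)).1 =
      ((a' * a₀ * a⁻¹) (ψ M (x p)).1.1, (b' * b₀ * b⁻¹) (ψ M (x p)).1.2) := by
    obtain ⟨y, rfl⟩ := (Surj.ofEquiv eτ).2 p
    rw [h y, h' y]
    simp [Surj.post]
  have horb : M' =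
      ((a' * a₀ * a⁻¹, b' * b₀ * b⁻¹) : Equiv.Perm (Fin k) × Equiv.Perm (Fin l)) • M := by
    refine QMat.ext_ones fun i j => ?_
    rw [QMat.smul_apply, QMat.mat_eq_one_iff (ψ M') x', QMat.mat_eq_one_iff (ψ M) x]
    refine exists_congr fun p => ?_
    rw [key, Prod.ext_iff, Prod.ext_iff]
    exact and_congr Equiv.Perm.eq_inv_iff_eq.symm Equiv.Perm.eq_inv_iff_eq.symm
  have hMM : M' = M := (hC M).unique ⟨hM', horb ▸ MulAction.mem_orbit _ _⟩
    ⟨hM, MulAction.mem_orbit_self _⟩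
  subst hMM
  let s : M'.Stab := ⟨(a' * a₀ * a⁻¹, b' * b₀ * b⁻¹), horb.symm⟩
  refine ⟨rfl, s, rfl, rfl, Equiv.ext fun p => (ψ M').injective (Subtype.ext ?_)⟩
  exact (key p).trans (QMat.stab_smul_apply (ψ M') s (x p)).symm

theorem exists_fits {C : Finset (QMat k l m)}
    (hC : ∀ M : QMat k l m, ∃! N : QMat k l m, N ∈ C ∧
      N ∈ MulAction.orbit (Equiv.Perm (Fin k) × Equiv.Perm (Fin l)) M)
    (ψ : ∀ M : QMat k l m, Fin m ≃ M.Ones) {f : Surj X k} {g : Surj X l}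
    (h : Setoid.ker f.1 ⊓ Setoid.ker g.1 = τ) :
    ∃ M ∈ C, ∃ a b x, Fits eτ (ψ M) a b x f g := by
  classical
  choose u hu using (Surj.ofEquiv eτ).2
  let j₀ : Fin m → Fin k × Fin l := fun p => (f.1 (u p), g.1 (u p))
  have hτ (y y' : X) : (f.1 y, g.1 y) = (f.1 y', g.1 y') ↔
      (Surj.ofEquiv eτ).1 y = (Surj.ofEquiv eτ).1 y' := by
    have hinf : (Setoid.ker f.1 ⊓ Setoid.ker g.1) y y' ↔ f.1 y = f.1 y' ∧ g.1 y = g.1 y' := Iff.rfl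
    rw [Prod.mk.injEq, ← hinf, h, ← Setoid.ker_def (f := (Surj.ofEquiv eτ).1), Surj.ker_ofEquiv]
  have hj (y : X) : j₀ ((Surj.ofEquiv eτ).1 y) = (f.1 y, g.1 y) := (hτ _ _).2 (hu _)
  have hj_inj : Function.Injective j₀ := fun p p' hp => by
    rw [← hu p, ← hu p']
    exact (hτ _ _).1 hp
  have hmat (i : Fin k) (j : Fin l) :
      (if ∃ p, j₀ p = (i, j) then (1 : Fin 2) else 0) = 1 ↔ ∃ p, j₀ p = (i, j) := by
    split_ifs with hp <;> simp [hp]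
  -- The `1`-entries are the values of `y ↦ (f y, g y)`. Its fibres are the parts of `τ`, so there
  -- are `m` of them; surjectivity of `f` and `g` excludes zero rows and columns.
  let M₀ : QMat k l m :=
    { mat := fun i j => if ∃ p, j₀ p = (i, j) then 1 else 0
      card_ones := by
        refine (Nat.card_congr (Equiv.ofBijective
          (fun p : Fin m => (⟨j₀ p, (hmat _ _).2 ⟨p, rfl⟩⟩ :
            {q : Fin k × Fin l // (if ∃ p, j₀ p = (q.1, q.2) then (1 : Fin 2) else 0) = 1}))
          ⟨fun p p' hp => hj_inj (congrArg Subtype.val hp), ?_⟩)).symm.trans (Nat.card_fin m)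
        rintro ⟨q, hq⟩
        obtain ⟨p, hp⟩ := (hmat _ _).1 hq
        exact ⟨p, Subtype.ext hp⟩
      row_ne_zero := fun i => by
        obtain ⟨y, rfl⟩ := f.2 i
        exact ⟨g.1 y, (hmat _ _).2 ⟨_, hj y⟩⟩
      col_ne_zero := fun j => by
        obtain ⟨y, rfl⟩ := g.2 j
        exact ⟨f.1 y, (hmat _ _).2 ⟨_, hj y⟩⟩ }
  obtain ⟨N, ⟨hN, ⟨c, hc⟩⟩, -⟩ := hC M₀
  have hone (p : Fin m) : N.mat (c.1 (j₀ p).1) (c.2 (j₀ p).2) = 1 := by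
    rw [← hc]
    change M₀.mat (c.1⁻¹ (c.1 _)) (c.2⁻¹ (c.2 _)) = 1
    rw [Equiv.Perm.inv_eq_iff_eq.2 rfl, Equiv.Perm.inv_eq_iff_eq.2 rfl]
    exact (hmat _ _).2 ⟨p, rfl⟩
  -- The permutation `x` compares the numbering of the parts of `τ` with the chosen numbering of the
  -- `1`-entries of `N`.
  let x₀ : Fin m → Fin m := fun p => (ψ N).symm ⟨(c.1 (j₀ p).1, c.2 (j₀ p).2), hone p⟩
  have hx₀ : Function.Injective x₀ := fun p p' hp => by
    have h1 := congrArg Subtype.val ((ψ N).symm.injective hp)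
    rw [Prod.mk.injEq] at h1
    exact hj_inj (Prod.ext (c.1.injective h1.1) (c.2.injective h1.2))
  refine ⟨N, hN, c.1, c.2, Equiv.ofBijective x₀ (Finite.injective_iff_bijective.1 hx₀),
    fun y => ?_⟩
  rw [Equiv.ofBijective_apply, Equiv.apply_symm_apply]
  exact congrArg (fun q : Fin k × Fin l => (c.1 q.1, c.2 q.2)) (hj y)

/-- The surjection given by the rows of the `1`-entries of a matrix. -/
def rowSurj (eτ : Quotient τ ≃ Fin m) {M : QMat k l m} (ψ : Fin m ≃ M.Ones)
    (x : Equiv.Perm (Fin m)) : Surj X k :=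
  ⟨fun y => (ψ (x ((Surj.ofEquiv eτ).1 y))).1.1, fun i => by
    obtain ⟨j, hj⟩ := M.row_ne_zero i
    obtain ⟨p, hp⟩ := (QMat.mat_eq_one_iff ψ x i j).1 hj
    obtain ⟨y, rfl⟩ := (Surj.ofEquiv eτ).2 p
    exact ⟨y, congrArg Prod.fst hp⟩⟩

/-- The surjection given by the columns of the `1`-entries of a matrix. -/
def colSurj (eτ : Quotient τ ≃ Fin m) {M : QMat k l m} (ψ : Fin m ≃ M.Ones)
    (x : Equiv.Perm (Fin m)) : Surj X l :=
  ⟨fun y => (ψ (x ((Surj.ofEquiv eτ).1 y))).1.2, fun j => by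
    obtain ⟨i, hi⟩ := M.col_ne_zero j
    obtain ⟨p, hp⟩ := (QMat.mat_eq_one_iff ψ x i j).1 hi
    obtain ⟨y, rfl⟩ := (Surj.ofEquiv eτ).2 p
    exact ⟨y, congrArg Prod.snd hp⟩⟩

theorem fits_rowSurj_colSurj {M : QMat k l m} (ψ : Fin m ≃ M.Ones) (x : Equiv.Perm (Fin m)) :
    Fits eτ ψ 1 1 x (rowSurj eτ ψ x) (colSurj eτ ψ x) := fun _ => rfl

theorem Fits.rowSurj_eq {M : QMat k l m} {ψ : Fin m ≃ M.Ones} {a : Equiv.Perm (Fin k)}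
    {b : Equiv.Perm (Fin l)} {x : Equiv.Perm (Fin m)} {f : Surj X k} {g : Surj X l}
    (h : Fits eτ ψ a b x f g) : rowSurj eτ ψ x = Surj.post a f :=
  Subtype.ext (funext fun y => congrArg Prod.fst (h y))

theorem Fits.colSurj_eq {M : QMat k l m} {ψ : Fin m ≃ M.Ones} {a : Equiv.Perm (Fin k)}
    {b : Equiv.Perm (Fin l)} {x : Equiv.Perm (Fin m)} {f : Surj X k} {g : Surj X l}
    (h : Fits eτ ψ a b x f g) : colSurj eτ ψ x = Surj.post b g :=
  Subtype.ext (funext fun y => congrArg Prod.snd (h y))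

theorem rowSurj_stabHom_mul {M : QMat k l m} (ψ : Fin m ≃ M.Ones) (s : M.Stab)
    (x : Equiv.Perm (Fin m)) :
    rowSurj eτ ψ (M.stabHom ψ s * x) = Surj.post s.1.1 (rowSurj eτ ψ x) :=
  Subtype.ext (funext fun _ => congrArg Prod.fst (QMat.stab_smul_apply ψ s _))

theorem colSurj_stabHom_mul {M : QMat k l m} (ψ : Fin m ≃ M.Ones) (s : M.Stab)
    (x : Equiv.Perm (Fin m)) :
    colSurj eτ ψ (M.stabHom ψ s * x) = Surj.post s.1.2 (colSurj eτ ψ x) :=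
  Subtype.ext (funext fun _ => congrArg Prod.snd (QMat.stab_smul_apply ψ s _))

/-- The factor `g⁻¹` on the right is the same as in `indRes_indGen`; this makes the comparison with
the induced modules equivariant. -/
theorem pushes_groupElem_rowSurj {M : QMat k l m} (ψ : Fin m ≃ M.Ones)
    (g x : Equiv.Perm (Fin m)) :
    (groupElem eτ g).Pushes (rowSurj eτ ψ x).1 (rowSurj eτ ψ (x * g⁻¹)).1 := fun y z h => by
  have h1 := pushes_groupElem eτ g y z h
  exact congrArg (fun p => (ψ (x p)).1.1) h1

theorem pushes_groupElem_colSurj {M : QMat k l m} (ψ : Fin m ≃ M.Ones)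
    (g x : Equiv.Perm (Fin m)) :
    (groupElem eτ g).Pushes (colSurj eτ ψ x).1 (colSurj eτ ψ (x * g⁻¹)).1 := fun y z h => by
  have h1 := pushes_groupElem eτ g y z h
  exact congrArg (fun p => (ψ (x p)).1.2) h1

end Pairs

/-! ### Linear maps on induced modules and on tensor products of the modules `N` -/

section Induced

variable {𝕜 : Type*} [Field 𝕜] {k l m : ℕ} {M : QMat k l m} (ψ : Fin m ≃ M.Ones)
  (lam mu : YoungDiagram)

/-- The element `x ⊗ u` of the induced module. -/
def indGen (x : Equiv.Perm (Fin m)) :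
    SpechtSpace 𝕜 k lam ⊗[𝕜] SpechtSpace 𝕜 l mu →ₗ[𝕜]
      Representation.IndV (M.stabHom ψ) (resStab 𝕜 M lam mu) :=
  Representation.IndV.mk (M.stabHom ψ) (resStab 𝕜 M lam mu) x

variable {lam mu}

theorem indRes_indGen (g x : Equiv.Perm (Fin m))
    (u : SpechtSpace 𝕜 k lam ⊗[𝕜] SpechtSpace 𝕜 l mu) :
    indRes 𝕜 M ψ lam mu g (indGen ψ lam mu x u) = indGen ψ lam mu (x * g⁻¹) u :=
  Representation.ind_mk (M.stabHom ψ) (resStab 𝕜 M lam mu) g x u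

theorem indGen_stabHom_mul (s : M.Stab) (x : Equiv.Perm (Fin m)) (v : SpechtSpace 𝕜 k lam)
    (w : SpechtSpace 𝕜 l mu) :
    indGen ψ lam mu (M.stabHom ψ s * x)
      (specht 𝕜 k lam s.1.1 v ⊗ₜ[𝕜] specht 𝕜 l mu s.1.2 w) = indGen ψ lam mu x (v ⊗ₜ[𝕜] w) := by
  have h := Representation.Coinvariants.mk_self_apply
    (V := MonoidAlgebra 𝕜 (Equiv.Perm (Fin m)) ⊗[𝕜] (SpechtSpace 𝕜 k lam ⊗[𝕜] SpechtSpace 𝕜 l mu))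
    (Representation.tprod ((Representation.leftRegular 𝕜 (Equiv.Perm (Fin m))).comp (M.stabHom ψ))
      (resStab 𝕜 M lam mu)) s (MonoidAlgebra.single x 1 ⊗ₜ[𝕜] (v ⊗ₜ[𝕜] w))
  rw [Representation.tprod_apply, TensorProduct.map_tmul] at h
  rw [MonoidHom.comp_apply, Representation.leftRegular, Representation.ofMulAction_single] at h
  exact h

theorem indV_hom_ext {W : Type*} [AddCommGroup W] [Module 𝕜 W]
    {F G : Representation.IndV (M.stabHom ψ) (resStab 𝕜 M lam mu) →ₗ[𝕜] W}
    (h : ∀ x v w, F (indGen ψ lam mu x (v ⊗ₜ[𝕜] w)) = G (indGen ψ lam mu x (v ⊗ₜ[𝕜] w))) :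
    F = G :=
  Representation.IndV.hom_ext _ _ fun x => TensorProduct.ext' fun v w => h x v w

theorem exists_indV_lift {W : Type*} [AddCommGroup W] [Module 𝕜 W]
    (F : Equiv.Perm (Fin m) → SpechtSpace 𝕜 k lam ⊗[𝕜] SpechtSpace 𝕜 l mu →ₗ[𝕜] W)
    (hF : ∀ (s : M.Stab) x v w, F (M.stabHom ψ s * x)
      (specht 𝕜 k lam s.1.1 v ⊗ₜ[𝕜] specht 𝕜 l mu s.1.2 w) = F x (v ⊗ₜ[𝕜] w)) :
    ∃ L : Representation.IndV (M.stabHom ψ) (resStab 𝕜 M lam mu) →ₗ[𝕜] W,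
      ∀ x u, L (indGen ψ lam mu x u) = F x u := by
  let L₀ : MonoidAlgebra 𝕜 (Equiv.Perm (Fin m)) ⊗[𝕜]
      (SpechtSpace 𝕜 k lam ⊗[𝕜] SpechtSpace 𝕜 l mu) →ₗ[𝕜] W :=
    TensorProduct.lift (Finsupp.linearCombination 𝕜 F ∘ₗ
      (MonoidAlgebra.coeffLinearEquiv 𝕜).toLinearMap)
  have hL₀ (x : Equiv.Perm (Fin m)) (u : SpechtSpace 𝕜 k lam ⊗[𝕜] SpechtSpace 𝕜 l mu) :
      L₀ (MonoidAlgebra.single x 1 ⊗ₜ u) = F x u := by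
    simp [L₀]
  refine ⟨Representation.Coinvariants.lift _ L₀ fun s => ?_, fun x u => hL₀ x u⟩
  refine TensorProduct.ext (MonoidAlgebra.lhom_ext' fun x => LinearMap.ext_ring
    (TensorProduct.ext' fun v w => ?_))
  have h : L₀ (MonoidAlgebra.single (M.stabHom ψ s * x) 1 ⊗ₜ[𝕜]
      (specht 𝕜 k lam s.1.1 v ⊗ₜ[𝕜] specht 𝕜 l mu s.1.2 w)) =
      L₀ (MonoidAlgebra.single x 1 ⊗ₜ[𝕜] (v ⊗ₜ[𝕜] w)) := by
    rw [hL₀, hL₀, hF]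
  rw [← smul_eq_mul, ← Representation.ofMulAction_single] at h
  exact h

end Induced

section TensorN

variable {𝕜 : Type*} [Field 𝕜] {X : Type*} {k l : ℕ} {ρ σ : Setoid X} (eρ : Quotient ρ ≃ Fin k)
  (eσ : Quotient σ ≃ Fin l) {lam mu : YoungDiagram} {W : Type*} [AddCommGroup W] [Module 𝕜 W]

theorem nSpace_tensor_hom_ext {F G : NSpace 𝕜 eρ lam ⊗[𝕜] NSpace 𝕜 eσ mu →ₗ[𝕜] W}
    (h : ∀ f g v w, F (nGen 𝕜 eρ lam f v ⊗ₜ[𝕜] nGen 𝕜 eσ mu g w) =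
      G (nGen 𝕜 eρ lam f v ⊗ₜ[𝕜] nGen 𝕜 eσ mu g w)) : F = G :=
  TensorProduct.ext (nSpace_hom_ext eρ fun f => LinearMap.ext fun v => nSpace_hom_ext eσ fun g =>
    LinearMap.ext fun w => h f g v w)

theorem exists_nSpace_tensor_lift
    (D : Surj X k → Surj X l → SpechtSpace 𝕜 k lam ⊗[𝕜] SpechtSpace 𝕜 l mu →ₗ[𝕜] W)
    (hD : ∀ f g a b v w, D (Surj.post a f) (Surj.post b g)
      (specht 𝕜 k lam a v ⊗ₜ[𝕜] specht 𝕜 l mu b w) = D f g (v ⊗ₜ[𝕜] w)) :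
    ∃ L : NSpace 𝕜 eρ lam ⊗[𝕜] NSpace 𝕜 eσ mu →ₗ[𝕜] W, ∀ f g v w,
      L (nGen 𝕜 eρ lam f v ⊗ₜ[𝕜] nGen 𝕜 eσ mu g w) = D f g (v ⊗ₜ[𝕜] w) := by
  have hpost {k : ℕ} (f : Surj X k) : Surj.post 1 f = f := rfl
  -- The map is built one factor at a time: `a = 1` gives the compatibility in the second factor,
  -- and later `b = 1` gives that in the first.
  have h1 (f : Surj X k) (v : SpechtSpace 𝕜 k lam) := exists_nSpace_lift eσ
    (fun g => D f g ∘ₗ TensorProduct.mk 𝕜 _ _ v) fun g b w => by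
      have h := hD f g 1 b v w
      rw [map_one, hpost] at h
      exact h
  choose B hB using h1
  let B' (f : Surj X k) : SpechtSpace 𝕜 k lam →ₗ[𝕜] NSpace 𝕜 eσ mu →ₗ[𝕜] W :=
    { toFun := B f
      map_add' := fun v v' => nSpace_hom_ext eσ fun g => LinearMap.ext fun w => by
        simp [hB]
      map_smul' := fun c v => nSpace_hom_ext eσ fun g => LinearMap.ext fun w => by
        simp [hB] }
  obtain ⟨L, hL⟩ := exists_nSpace_lift eρ B' fun f a v => nSpace_hom_ext eσ fun g =>
    LinearMap.ext fun w => by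
      have h := hD f g a 1 v w
      rw [map_one, hpost] at h
      exact (hB _ _ _ _).trans (h.trans (hB _ _ _ _).symm)
  refine ⟨TensorProduct.lift L, fun f g v w => ?_⟩
  rw [TensorProduct.lift.tmul, hL]
  exact hB f v g w

end TensorN

/-! ### The top vectors of a tensor product of two modules `N` -/

section TensorTop

open DualSymInv

variable {𝕜 : Type*} [Field 𝕜] {X : Type*} {k l m : ℕ} {ρ σ τ : Setoid X}
  (eρ : Quotient ρ ≃ Fin k) (eσ : Quotient σ ≃ Fin l) (eτ : Quotient τ ≃ Fin m)
  {lam mu : YoungDiagram} {C : Finset (QMat k l m)} (ψ : ∀ M : QMat k l m, Fin m ≃ M.Ones)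

variable (𝕜 lam mu) in
/-- The pure tensor of two generators of the modules `N`. -/
def pairGen (f : Surj X k) (g : Surj X l) (v : SpechtSpace 𝕜 k lam) (w : SpechtSpace 𝕜 l mu) :
    ((simpleRep 𝕜 eρ lam).tprod (simpleRep 𝕜 eσ mu)).asModule :=
  (nGen 𝕜 eρ lam f v ⊗ₜ[𝕜] nGen 𝕜 eσ mu g w : NSpace 𝕜 eρ lam ⊗[𝕜] NSpace 𝕜 eσ mu)

theorem pairGen_post (f : Surj X k) (g : Surj X l) (a : Equiv.Perm (Fin k))
    (b : Equiv.Perm (Fin l)) (v : SpechtSpace 𝕜 k lam) (w : SpechtSpace 𝕜 l mu) :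
    pairGen 𝕜 eρ eσ lam mu (Surj.post a f) (Surj.post b g) (specht 𝕜 k lam a v)
      (specht 𝕜 l mu b w) = pairGen 𝕜 eρ eσ lam mu f g v w := by
  rw [pairGen, nGen_post, nGen_post, pairGen]

theorem single_smul_pairGen {ξ : DualSymInv X} {f f' : Surj X k} {g g' : Surj X l}
    (hf : ξ.Pushes f.1 f'.1) (hg : ξ.Pushes g.1 g'.1) (v : SpechtSpace 𝕜 k lam)
    (w : SpechtSpace 𝕜 l mu) :
    MonoidAlgebra.single ξ (1 : 𝕜) • pairGen 𝕜 eρ eσ lam mu f g v w =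
      pairGen 𝕜 eρ eσ lam mu f' g' v w := by
  rw [single_smul_asModule]
  change simpleRep 𝕜 eρ lam ξ _ ⊗ₜ[𝕜] simpleRep 𝕜 eσ mu ξ _ = _
  rw [simpleRep_nGen eρ hf, simpleRep_nGen eσ hg, pairGen]

theorem idemAlg_smul_pairGen {θ : Setoid X} {f : Surj X k} {g : Surj X l}
    (h : θ ≤ Setoid.ker f.1 ⊓ Setoid.ker g.1) (v : SpechtSpace 𝕜 k lam)
    (w : SpechtSpace 𝕜 l mu) :
    idemAlg 𝕜 θ • pairGen 𝕜 eρ eσ lam mu f g v w = pairGen 𝕜 eρ eσ lam mu f g v w :=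
  single_smul_pairGen eρ eσ (pushes_idem (h.trans inf_le_left)) (pushes_idem (h.trans inf_le_right))
    v w

theorem idemAlg_smul_pairGen_eq_zero {θ : Setoid X} {f : Surj X k} {g : Surj X l}
    (h : ¬ θ ≤ Setoid.ker f.1 ⊓ Setoid.ker g.1) (v : SpechtSpace 𝕜 k lam)
    (w : SpechtSpace 𝕜 l mu) :
    idemAlg 𝕜 θ • pairGen 𝕜 eρ eσ lam mu f g v w = 0 := by
  rw [idemAlg, single_smul_asModule]
  change simpleRep 𝕜 eρ lam (idem θ) _ ⊗ₜ[𝕜] simpleRep 𝕜 eσ mu (idem θ) _ = 0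
  by_cases hf : θ ≤ Setoid.ker f.1
  · rw [simpleRep_idem_nGen_eq_zero eσ (fun hg => h (le_inf hf hg)), TensorProduct.tmul_zero]
  · rw [simpleRep_idem_nGen_eq_zero eρ hf, TensorProduct.zero_tmul]

theorem primIdem_smul_pairGen [Finite X] {f : Surj X k} {g : Surj X l}
    (h : Setoid.ker f.1 ⊓ Setoid.ker g.1 = τ) (v : SpechtSpace 𝕜 k lam)
    (w : SpechtSpace 𝕜 l mu) :
    primIdem 𝕜 τ • pairGen 𝕜 eρ eσ lam mu f g v w = pairGen 𝕜 eρ eσ lam mu f g v w :=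
  primIdem_smul_of_mem 𝕜 ⟨idemAlg_smul_pairGen eρ eσ h.ge v w, fun θ hθ =>
    idemAlg_smul_pairGen_eq_zero eρ eσ (by rw [h]; exact hθ.not_ge) v w⟩

theorem primIdem_smul_pairGen_eq_zero [Finite X] {f : Surj X k} {g : Surj X l}
    (h : Setoid.ker f.1 ⊓ Setoid.ker g.1 ≠ τ) (v : SpechtSpace 𝕜 k lam)
    (w : SpechtSpace 𝕜 l mu) :
    primIdem 𝕜 τ • pairGen 𝕜 eρ eσ lam mu f g v w = 0 := by
  by_cases hle : τ ≤ Setoid.ker f.1 ⊓ Setoid.ker g.1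
  -- Here `ker f ⊓ ker g` is strictly coarser than `τ`; its idempotent fixes the tensor but
  -- annihilates `primIdem`. In the other case `e_τ` already kills the tensor.
  · rw [← idemAlg_smul_pairGen eρ eσ le_rfl, smul_smul, ← (commute_primIdem 𝕜 _).eq,
      idemAlg_mul_primIdem 𝕜 (lt_of_le_of_ne hle h.symm), zero_smul]
  · rw [← idemAlg_mul_primIdem_self, (commute_primIdem 𝕜 τ).eq, mul_smul,
      idemAlg_smul_pairGen_eq_zero eρ eσ hle, smul_zero]

variable (𝕜 lam mu C) in
/-- The product of the induced modules over a set of matrices. -/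
abbrev IndProd : Type _ := (M : C) → (indRes 𝕜 M.1 (ψ M.1) lam mu).asModule

open Classical in
variable (𝕜 lam mu) in
/-- The element `x ⊗ u` of the induced module at a matrix. -/
def prodGen (M : C) (x : Equiv.Perm (Fin m)) :
    SpechtSpace 𝕜 k lam ⊗[𝕜] SpechtSpace 𝕜 l mu →ₗ[𝕜] IndProd 𝕜 lam mu C ψ :=
  LinearMap.single 𝕜 (fun M : C => (indRes 𝕜 M.1 (ψ M.1) lam mu).asModule) M ∘ₗ
    (indGen (ψ M.1) lam mu x :
      SpechtSpace 𝕜 k lam ⊗[𝕜] SpechtSpace 𝕜 l mu →ₗ[𝕜] (indRes 𝕜 M.1 (ψ M.1) lam mu).asModule)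

theorem prodGen_stabHom_mul (M : C) (s : M.1.Stab) (x : Equiv.Perm (Fin m))
    (v : SpechtSpace 𝕜 k lam) (w : SpechtSpace 𝕜 l mu) :
    prodGen 𝕜 lam mu ψ M (M.1.stabHom (ψ M.1) s * x)
      (specht 𝕜 k lam s.1.1 v ⊗ₜ[𝕜] specht 𝕜 l mu s.1.2 w) =
        prodGen 𝕜 lam mu ψ M x (v ⊗ₜ[𝕜] w) := by
  classical
  exact congrArg (LinearMap.single 𝕜 (fun M : C => (indRes 𝕜 M.1 (ψ M.1) lam mu).asModule) M)
    (indGen_stabHom_mul (ψ M.1) s x v w)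

theorem single_smul_prodGen (g : Equiv.Perm (Fin m)) (M : C) (x : Equiv.Perm (Fin m))
    (u : SpechtSpace 𝕜 k lam ⊗[𝕜] SpechtSpace 𝕜 l mu) :
    MonoidAlgebra.single g (1 : 𝕜) • prodGen 𝕜 lam mu ψ M x u =
      prodGen 𝕜 lam mu ψ M (x * g⁻¹) u := by
  classical
  have h : MonoidAlgebra.single g (1 : 𝕜) •
      (show (indRes 𝕜 M.1 (ψ M.1) lam mu).asModule from indGen (ψ M.1) lam mu x u) =
        (show (indRes 𝕜 M.1 (ψ M.1) lam mu).asModule from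
          indGen (ψ M.1) lam mu (x * g⁻¹) u) := by
    rw [single_smul_asModule]
    exact indRes_indGen (ψ M.1) g x u
  exact (Pi.single_smul M (MonoidAlgebra.single g (1 : 𝕜)) _).symm.trans (congrArg (Pi.single M) h)

theorem indProd_hom_ext {W : Type*} [AddCommGroup W] [Module 𝕜 W]
    {F G : IndProd 𝕜 lam mu C ψ →ₗ[𝕜] W}
    (h : ∀ M x v w, F (prodGen 𝕜 lam mu ψ M x (v ⊗ₜ[𝕜] w)) =
      G (prodGen 𝕜 lam mu ψ M x (v ⊗ₜ[𝕜] w))) : F = G := by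
  classical
  refine LinearMap.pi_ext' fun M => ?_
  exact indV_hom_ext (ψ M.1) fun x v w => h M x v w

/-- Two fittings differ by the stabilizer, which is divided out in the induced module. So the
inverse map may be defined with an arbitrary choice of fitting. -/
theorem Fits.prodGen_eq
    (hC : ∀ M : QMat k l m, ∃! N : QMat k l m, N ∈ C ∧
      N ∈ MulAction.orbit (Equiv.Perm (Fin k) × Equiv.Perm (Fin l)) M)
    {eτ : Quotient τ ≃ Fin m} {M M' : C} {a a' : Equiv.Perm (Fin k)}
    {b b' : Equiv.Perm (Fin l)} {x x' : Equiv.Perm (Fin m)} {f : Surj X k} {g : Surj X l}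
    (h : Fits eτ (ψ M) a b x f g) (h' : Fits eτ (ψ M') a' b' x' f g)
    (v : SpechtSpace 𝕜 k lam) (w : SpechtSpace 𝕜 l mu) :
    prodGen 𝕜 lam mu ψ M' x' (specht 𝕜 k lam a' v ⊗ₜ[𝕜] specht 𝕜 l mu b' w) =
      prodGen 𝕜 lam mu ψ M x (specht 𝕜 k lam a v ⊗ₜ[𝕜] specht 𝕜 l mu b w) := by
  obtain ⟨M, hM⟩ := M
  obtain ⟨M', hM'⟩ := M'
  obtain ⟨rfl, s, hs1, hs2, rfl⟩ := Fits.stab hC hM hM' (a₀ := 1) (b₀ := 1) h h'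
  rw [← prodGen_stabHom_mul ψ ⟨M', hM⟩ s x, hs1, hs2]
  simp only [← Module.End.mul_apply, ← map_mul, mul_one, inv_mul_cancel_right]

theorem exists_indProd_to_tensor :
    ∃ Φ : IndProd 𝕜 lam mu C ψ →ₗ[𝕜] ((simpleRep 𝕜 eρ lam).tprod (simpleRep 𝕜 eσ mu)).asModule,
      ∀ M x v w, Φ (prodGen 𝕜 lam mu ψ M x (v ⊗ₜ[𝕜] w)) =
        pairGen 𝕜 eρ eσ lam mu (rowSurj eτ (ψ M.1) x) (colSurj eτ (ψ M.1) x) v w := by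
  classical
  have h (M : C) := exists_indV_lift (𝕜 := 𝕜) (lam := lam) (mu := mu) (ψ M.1)
    (W := ((simpleRep 𝕜 eρ lam).tprod (simpleRep 𝕜 eσ mu)).asModule)
    (fun x => TensorProduct.map (nGen 𝕜 eρ lam (rowSurj eτ (ψ M.1) x))
      (nGen 𝕜 eσ mu (colSurj eτ (ψ M.1) x))) fun s x v w => by
        rw [rowSurj_stabHom_mul, colSurj_stabHom_mul]
        exact pairGen_post eρ eσ _ _ _ _ v w
  choose L hL using h
  let L' (M : C) : (indRes 𝕜 M.1 (ψ M.1) lam mu).asModule →ₗ[𝕜]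
    ((simpleRep 𝕜 eρ lam).tprod (simpleRep 𝕜 eσ mu)).asModule := L M
  refine ⟨LinearMap.lsum 𝕜 (fun M : C => (indRes 𝕜 M.1 (ψ M.1) lam mu).asModule) 𝕜 L',
    fun M x v w => ?_⟩
  exact (LinearMap.lsum_piSingle 𝕜 _ 𝕜 L' M _).trans (hL M x _)

/-- A pair goes to the generator given by any of its fittings, and to `0` if it has none. Permuting
the pair only changes the fitting, so this respects the relations of both modules `N`. -/
theorem exists_tensor_to_indProd
    (hC : ∀ M : QMat k l m, ∃! N : QMat k l m, N ∈ C ∧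
      N ∈ MulAction.orbit (Equiv.Perm (Fin k) × Equiv.Perm (Fin l)) M) :
    ∃ Ψ : ((simpleRep 𝕜 eρ lam).tprod (simpleRep 𝕜 eσ mu)).asModule →ₗ[𝕜] IndProd 𝕜 lam mu C ψ,
      (∀ (M : C) a b x f g v w, Fits eτ (ψ M.1) a b x f g →
        Ψ (pairGen 𝕜 eρ eσ lam mu f g v w) =
          prodGen 𝕜 lam mu ψ M x (specht 𝕜 k lam a v ⊗ₜ[𝕜] specht 𝕜 l mu b w)) ∧
      ∀ f g v w, Setoid.ker f.1 ⊓ Setoid.ker g.1 ≠ τ →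
        Ψ (pairGen 𝕜 eρ eσ lam mu f g v w) = 0 := by
  classical
  let P (f : Surj X k) (g : Surj X l)
    (q : C × Equiv.Perm (Fin k) × Equiv.Perm (Fin l) × Equiv.Perm (Fin m)) : Prop :=
    Fits eτ (ψ q.1.1) q.2.1 q.2.2.1 q.2.2.2 f g
  let D (f : Surj X k) (g : Surj X l) :
      SpechtSpace 𝕜 k lam ⊗[𝕜] SpechtSpace 𝕜 l mu →ₗ[𝕜] IndProd 𝕜 lam mu C ψ :=
    if h : ∃ q, P f g q then prodGen 𝕜 lam mu ψ h.choose.1 h.choose.2.2.2 ∘ₗ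
      TensorProduct.map (specht 𝕜 k lam h.choose.2.1) (specht 𝕜 l mu h.choose.2.2.1) else 0
  have hD {M : C} {a b x f g} (h : Fits eτ (ψ M.1) a b x f g) (v : SpechtSpace 𝕜 k lam)
      (w : SpechtSpace 𝕜 l mu) : D f g (v ⊗ₜ[𝕜] w) =
        prodGen 𝕜 lam mu ψ M x (specht 𝕜 k lam a v ⊗ₜ[𝕜] specht 𝕜 l mu b w) := by
    have hex : ∃ q, P f g q := ⟨(M, a, b, x), h⟩
    simp only [D, dif_pos hex, LinearMap.comp_apply, TensorProduct.map_tmul]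
    exact h.prodGen_eq ψ hC hex.choose_spec v w
  have hD0 {f g} (h : ¬ ∃ q, P f g q) : D f g = 0 := dif_neg h
  obtain ⟨Ψ, hΨ⟩ := exists_nSpace_tensor_lift eρ eσ D fun f g a₀ b₀ v w => by
    by_cases h : ∃ q, P (Surj.post a₀ f) (Surj.post b₀ g) q
    · obtain ⟨⟨M, a, b, x⟩, hq⟩ := h
      have h1 : Fits eτ (ψ M.1) (a * a₀) (b * b₀) x f g := hq
      rw [hD hq, hD h1, map_mul, map_mul]
      rfl
    · have h1 : ¬ ∃ q, P f g q := by
        rintro ⟨⟨M, a, b, x⟩, hq⟩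
        refine h ⟨⟨M, a * a₀⁻¹, b * b₀⁻¹, x⟩, fun y => (hq y).trans ?_⟩
        simp [Surj.post]
      rw [hD0 h, hD0 h1]
      rfl
  refine ⟨Ψ, fun M a b x f g v w h => (hΨ f g v w).trans (hD h v w), fun f g v w h => ?_⟩
  refine (hΨ f g v w).trans ?_
  rw [hD0, LinearMap.zero_apply]
  rintro ⟨q, hq⟩
  exact h hq.ker_inf_ker

/-- The top vectors of a tensor product of two modules `N` form a product of induced modules. -/
theorem exists_indProd_equiv_topVectors [Finite X]
    (hC : ∀ M : QMat k l m, ∃! N : QMat k l m, N ∈ C ∧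
      N ∈ MulAction.orbit (Equiv.Perm (Fin k) × Equiv.Perm (Fin l)) M) :
    ∃ Φ : IndProd 𝕜 lam mu C ψ →ₗ[𝕜] ((simpleRep 𝕜 eρ lam).tprod (simpleRep 𝕜 eσ mu)).asModule,
      (∀ (g : Equiv.Perm (Fin m)) y, Φ (MonoidAlgebra.single g (1 : 𝕜) • y) =
        MonoidAlgebra.single (groupElem eτ g) (1 : 𝕜) • Φ y) ∧
      Function.Injective Φ ∧ LinearMap.range Φ =
        topVectors 𝕜 τ ((simpleRep 𝕜 eρ lam).tprod (simpleRep 𝕜 eσ mu)).asModule := by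
  obtain ⟨Φ, hΦ⟩ := exists_indProd_to_tensor (𝕜 := 𝕜) eρ eσ eτ (lam := lam) (mu := mu) (C := C) ψ
  obtain ⟨Ψ, hΨ, hΨ0⟩ :=
    exists_tensor_to_indProd (𝕜 := 𝕜) eρ eσ eτ (lam := lam) (mu := mu) (C := C) ψ hC
  have hΨΦ : Ψ ∘ₗ Φ = LinearMap.id := indProd_hom_ext ψ fun M x v w => by
    rw [LinearMap.comp_apply, hΦ, hΨ M 1 1 x _ _ v w (fits_rowSurj_colSurj (ψ M.1) x), map_one,
      map_one]
    rfl
  -- One composite is the identity and the other is the projection onto the top vectors, so `Φ` is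
  -- injective with exactly that image.
  have hΦΨ : Φ ∘ₗ Ψ = Algebra.lsmul 𝕜 𝕜 _ (primIdem 𝕜 τ) :=
    nSpace_tensor_hom_ext eρ eσ fun f g v w => by
      change Φ (Ψ (pairGen 𝕜 eρ eσ lam mu f g v w)) =
        primIdem 𝕜 τ • pairGen 𝕜 eρ eσ lam mu f g v w
      by_cases h : Setoid.ker f.1 ⊓ Setoid.ker g.1 = τ
      · obtain ⟨M, hM, a, b, x, hfit⟩ := exists_fits (eτ := eτ) hC ψ h
        rw [primIdem_smul_pairGen eρ eσ h, hΨ ⟨M, hM⟩ a b x f g v w hfit, hΦ, hfit.rowSurj_eq,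
          hfit.colSurj_eq, pairGen_post]
      · rw [primIdem_smul_pairGen_eq_zero eρ eσ h, hΨ0 f g v w h, map_zero]
  have h1 (y) : Ψ (Φ y) = y := LinearMap.congr_fun hΨΦ y
  have h2 (z) : Φ (Ψ z) = primIdem 𝕜 τ • z := LinearMap.congr_fun hΦΨ z
  refine ⟨Φ, fun g => ?_, Function.LeftInverse.injective h1, ?_⟩
  · have h : Φ ∘ₗ Algebra.lsmul 𝕜 𝕜 _ (MonoidAlgebra.single g (1 : 𝕜)) =
        Algebra.lsmul 𝕜 𝕜 _ (MonoidAlgebra.single (groupElem eτ g) (1 : 𝕜)) ∘ₗ Φ :=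
      indProd_hom_ext ψ fun M x v w => by
        change Φ (MonoidAlgebra.single g (1 : 𝕜) • _) =
          MonoidAlgebra.single (groupElem eτ g) (1 : 𝕜) • Φ _
        rw [single_smul_prodGen, hΦ, hΦ, single_smul_pairGen eρ eσ
          (pushes_groupElem_rowSurj (ψ M.1) g x) (pushes_groupElem_colSurj (ψ M.1) g x)]
    exact fun y => LinearMap.congr_fun h y
  · ext z
    constructor
    · rintro ⟨y, rfl⟩
      rw [← h1 y, h2]
      exact primIdem_smul_mem 𝕜 _
    · intro hz
      exact ⟨Ψ z, by rw [h2, primIdem_smul_of_mem 𝕜 hz]⟩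

end TensorTop

/-! ### The multiplicities -/

instance (𝕜 : Type*) [Field 𝕜] (k : ℕ) (lam : YoungDiagram) :
    FiniteDimensional 𝕜 (SpechtSpace 𝕜 k lam) :=
  FiniteDimensional.span_of_finite 𝕜 (Set.finite_range _)

instance {X : Type*} [Finite X] (𝕜 : Type*) [Field 𝕜] {k : ℕ} {ρ : Setoid X}
    (e : Quotient ρ ≃ Fin k) (lam : YoungDiagram) : FiniteDimensional 𝕜 (NSpace 𝕜 e lam) := by
  have : Finite (LeftCell (DualSymInv.idem ρ)) := Subtype.finite
  exact Module.Finite.of_surjective _ (Submodule.mkQ_surjective _)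

instance {𝕜 : Type*} [Field 𝕜] {k l m : ℕ} (M : QMat k l m) (ψ : Fin m ≃ M.Ones)
    (lam mu : YoungDiagram) : FiniteDimensional 𝕜 (indRes 𝕜 M ψ lam mu).asModule := by
  have h : FiniteDimensional 𝕜 (Representation.IndV
      (A := SpechtSpace 𝕜 k lam ⊗[𝕜] SpechtSpace 𝕜 l mu) (M.stabHom ψ) (resStab 𝕜 M lam mu)) := by
    have : FiniteDimensional 𝕜 (MonoidAlgebra 𝕜 (Equiv.Perm (Fin m))) :=
      inferInstance
    exact Module.Finite.of_surjective _ (Submodule.mkQ_surjective _)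
  exact h

/-- The fixed vectors of a product of modules are the products of fixed vectors. -/
theorem finrank_fixedVectors_pi {𝕜 B ι : Type*} [Field 𝕜] [Ring B] [Algebra 𝕜 B] [Fintype ι]
    (e : B) {M : ι → Type*} [∀ i, AddCommGroup (M i)] [∀ i, Module 𝕜 (M i)] [∀ i, Module B (M i)]
    [∀ i, IsScalarTower 𝕜 B (M i)] [∀ i, FiniteDimensional 𝕜 (M i)] :
    Module.finrank 𝕜 (fixedVectors 𝕜 e (∀ i, M i)) =
      ∑ i, Module.finrank 𝕜 (fixedVectors 𝕜 e (M i)) := by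
  rw [← Module.finrank_pi_fintype]
  exact LinearEquiv.finrank_eq
    { toFun := fun v i => ⟨v.1 i, congrFun v.2 i⟩
      map_add' := fun _ _ => rfl
      map_smul' := fun _ _ => rfl
      invFun := fun v => ⟨fun i => (v i).1, funext fun i => (v i).2⟩
      left_inv := fun _ => rfl
      right_inv := fun _ => rfl }

end

theorem mainTheorem5 {𝕜 : Type*} [Field 𝕜] [IsAlgClosed 𝕜] [CharZero 𝕜] {n k l m : ℕ}
    (ρ σ τ : Setoid (Fin n))
    (eρ : Quotient ρ ≃ Fin k) (eσ : Quotient σ ≃ Fin l) (eτ : Quotient τ ≃ Fin m)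
    (lam mu nu : YoungDiagram) (hlam : lam.card = k) (hmu : mu.card = l) (hnu : nu.card = m)
    (C : Finset (QMat k l m))
    (hC : ∀ M : QMat k l m, ∃! N : QMat k l m, N ∈ C ∧
      N ∈ MulAction.orbit (Equiv.Perm (Fin k) × Equiv.Perm (Fin l)) M)
    (ψ : ∀ M : QMat k l m, Fin m ≃ M.Ones) :
    repMultiplicity ((simpleRep 𝕜 eρ lam).tprod (simpleRep 𝕜 eσ mu)) (simpleRep 𝕜 eτ nu) =
      ∑ M ∈ C, repMultiplicity (indRes 𝕜 M (ψ M) lam mu) (specht 𝕜 m nu) := by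
  have hS := specht_isSimpleModule 𝕜 hnu
  have hS' := IsSimpleModule.nontrivial (MonoidAlgebra 𝕜 (Equiv.Perm (Fin m)))
    (specht 𝕜 m nu).asModule
  have : NeZero (Nat.card (Equiv.Perm (Fin m)) : 𝕜) := ⟨by simp⟩
  obtain ⟨ε, hε, ⟨θ⟩⟩ := IsSemisimpleRing.exists_idempotent_of_isSimpleModule
    (B := MonoidAlgebra 𝕜 (Equiv.Perm (Fin m))) (M := (specht 𝕜 m nu).asModule)
  have : FiniteDimensional 𝕜 (specht 𝕜 m nu).asModule :=
    inferInstanceAs (FiniteDimensional 𝕜 (SpechtSpace 𝕜 m nu))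
  have : FiniteDimensional 𝕜 ((simpleRep 𝕜 eρ lam).tprod (simpleRep 𝕜 eσ mu)).asModule :=
    inferInstanceAs (FiniteDimensional 𝕜 (NSpace 𝕜 eρ lam ⊗[𝕜] NSpace 𝕜 eσ mu))
  have hpos : Module.finrank 𝕜 (fixedVectors 𝕜 ε (specht 𝕜 m nu).asModule) ≠ 0 := fun h =>
    fixedVectors_ne_bot_of_linearEquiv_span 𝕜 hε θ (Submodule.finrank_eq_zero.1 h)
  obtain ⟨Φ, hΦ, hinj, hrange⟩ :=
    exists_indProd_equiv_topVectors (𝕜 := 𝕜) (lam := lam) (mu := mu) eρ eσ eτ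
      (C := C) (fun M => ψ M) hC
  have hleft := compMultiplicity_mul_finrank 𝕜
    (M := ((simpleRep 𝕜 eρ lam).tprod (simpleRep 𝕜 eσ mu)).asModule)
    (S := (simpleRep 𝕜 eτ nu).asModule) (isIdempotentElem_liftIdem 𝕜 eτ hε)
    fun _ => nonempty_linearEquiv_simpleRep eτ hε θ
  rw [finrank_fixedVectors_liftIdem 𝕜 eτ hΦ hinj hrange hε,
    finrank_fixedVectors_liftIdem 𝕜 eτ (nBase_single_smul eτ)
      (nGen_injective eτ (Surj.ofEquiv eτ)) (range_nBase eτ) hε,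
    finrank_fixedVectors_pi] at hleft
  have hright (M : QMat k l m) := compMultiplicity_mul_finrank 𝕜
    (M := (indRes 𝕜 M (ψ M) lam mu).asModule)
    (S := (specht 𝕜 m nu).asModule) hε fun _ =>
      nonempty_linearEquiv_of_fixedVectors_ne_bot θ
  -- All multiplicities appear multiplied by the same nonzero number `dim ε S^ν`, which cancels
  -- whatever its value is.
  refine Nat.eq_of_mul_eq_mul_right (Nat.pos_of_ne_zero hpos) (hleft.trans ?_)
  rw [Finset.sum_mul, ← Finset.sum_coe_sort C]
  exact Finset.sum_congr rfl fun M _ => (hright M.1).symm
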